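/- Leader election among $n\ge 2$ processors proceeds in rounds. In each round every active processor tosses a fair coin (all tosses independent); those showing heads stay active and the others drop out, except that if no active processor shows heads, all of them stay active. The election ends when a single processor is active. For $n\ge 2$ let $b_n$ be distributed as the number of rounds needed when all $n$ processors are active at the start, and let $I_n$ be uniformly distributed on $\{0,\dots,n-1\}$. Let $(Y_n)_{n\ge 0}$ be nonnegative-integer-valued random variables with $Y_0=Y_1=1$ almost surely and $$Y_n \stackrel{\mathcal L}{=} Y_{I_n}+b_n,\qquad n\ge 2,$$ where, for each $n\ge 2$, the pair $(I_n,b_n)$ is independent of the sequence $(Y_k)_{k\ge 0}$. (This recurrence is satisfied by the running time $Y_n$, in rounds, of the maximum-finding Algorithm B of Chen and Hwang for a broadcast communication model with $n$ processors.) Then $\mathbb E Y_n^3<\infty$ for all $n$, $\operatorname{Var}(Y_n)>0$ for all sufficiently large $n$, and, as $n\to\infty$, $$\zeta_3\!\left(\frac{Y_n-\mathbb EY_n}{\sqrt{\operatorname{Var}(Y_n)}},\,\mathcal N(0,1)\right)=O\!\left(\frac1{\sqrt{\ln n}}\right).$$ Here $\zeta_3(V,W)=\sup_{f\in\mathcal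 F_3}|\mathbb Ef(V)-\mathbb Ef(W)|$ is the Zolotarev metric, where $\mathcal F_3$ is the set of all $f\in C^2(\mathbb R,\mathbb R)$ with $|f''(x)-f''(y)|\le|x-y|$ for all $x,y\in\mathbb R$. -/

import Mathlib

open MeasureTheory ProbabilityTheory Filter
open scoped ENNReal

/-- The processors that are still active after `t` rounds of leader election, where `toss s p` is the
coin of processor `p` in round `s`. In each round all active processors toss; those showing heads
(`true`) stay active, the others drop out, except that if no active processor shows heads,
the round is void and all of them stay active. -/
def survivors {n : ℕ} (toss : ℕ → Fin n → Bool) : ℕ → Finset (Fin n)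
  | 0 => Finset.univ
  | t + 1 =>
    if ((survivors toss t).filter fun p => toss t p = true).Nonempty then
      (survivors toss t).filter fun p => toss t p = true
    else survivors toss t

/-- The number of rounds until only one processor (the leader) is active. The infimum is over a
nonempty set for almost all sequences of tosses. -/
noncomputable def electionTime {n : ℕ} (toss : ℕ → Fin n → Bool) : ℕ :=
  sInf {t | (survivors toss t).card ≤ 1}

/-- A fair coin. -/
noncomputable def fairCoin : Measure Bool := (PMF.uniformOfFintype Bool).toMeasure

instance : IsProbabilityMeasure fairCoin := by
  unfold fairCoin; infer_instance

/-- The distribution of the number of rounds of leader election among `n` processors, all tosses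
being independent and fair. -/
noncomputable def electionLaw (n : ℕ) : Measure ℕ :=
  (Measure.infinitePi fun _ : ℕ => Measure.pi fun _ : Fin n => fairCoin).map electionTime

/-- `electionTime` is measurable, so that `electionLaw n` is a genuine push-forward. -/
theorem measurable_electionTime (n : ℕ) :
    Measurable (electionTime : (ℕ → Fin n → Bool) → ℕ) := by
  let _ : MeasurableSpace (Finset (Fin n)) := ⊤
  have hs : ∀ t, Measurable fun toss : ℕ → Fin n → Bool => survivors toss t := by
    intro t
    induction t with
    | zero => exact measurable_const
    | succ t ih =>
      have hF : Measurable fun q : Finset (Fin n) × (Fin n → Bool) =>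
          if (q.1.filter fun p => q.2 p = true).Nonempty then
            q.1.filter fun p => q.2 p = true else q.1 := measurable_of_countable _
      exact hF.comp (ih.prodMk (measurable_pi_apply t))
  have hc : ∀ t, MeasurableSet {toss : ℕ → Fin n → Bool | (survivors toss t).card ≤ 1} :=
    fun t => hs t (MeasurableSpace.measurableSet_top (s := {s : Finset (Fin n) | s.card ≤ 1}))
  refine measurable_of_Iic fun k => ?_
  have : (electionTime : (ℕ → Fin n → Bool) → ℕ) ⁻¹' Set.Iic k =
      (⋃ t ∈ Set.Iic k, {toss | (survivors toss t).card ≤ 1}) ∪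
        ⋂ t, {toss | (survivors toss t).card ≤ 1}ᶜ := by
    ext toss
    simp only [Set.mem_preimage, Set.mem_Iic, Set.mem_union, Set.mem_iUnion, Set.mem_iInter,
      Set.mem_compl_iff, Set.mem_ofPred_eq, electionTime]
    constructor
    · intro h
      by_cases hne : {t | (survivors toss t).card ≤ 1}.Nonempty
      · exact Or.inl ⟨_, h, Nat.sInf_mem hne⟩
      · exact Or.inr fun t ht => hne ⟨t, ht⟩
    · rintro (⟨t, ht, h⟩ | h)
      · exact le_trans (Nat.sInf_le (Set.mem_ofPred_eq.symm ▸ h)) ht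
      · have : {t | (survivors toss t).card ≤ 1} = ∅ := Set.eq_empty_of_forall_notMem h
        simp [this]
  rw [this]
  exact (MeasurableSet.biUnion (Set.to_countable _) fun t _ => hc t).union
    (MeasurableSet.iInter fun t => (hc t).compl)

/-- The twice continuously differentiable functions whose second derivative is Lipschitz
continuous with constant `1`. -/
def zolotarevClass : Set (ℝ → ℝ) :=
  {f | ContDiff ℝ 2 f ∧ ∀ x y, |iteratedDeriv 2 f x - iteratedDeriv 2 f y| ≤ |x - y|}

/-- The Zolotarev distance `ζ₃` of two distributions (with finite third absolute moments, so that
every `f` in the class is integrable), with values in `[0, ∞]`. -/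
noncomputable def zolotarev3 (μ ν : Measure ℝ) : ℝ≥0∞ :=
  ⨆ f ∈ zolotarevClass, ENNReal.ofReal |∫ x, f x ∂μ - ∫ x, f x ∂ν|

/-- The normalization `(X - 𝔼 X) / √(Var X)`. -/
noncomputable def standardize {Ω : Type*} [MeasurableSpace Ω] (P : Measure Ω) (X : Ω → ℝ) :
    Ω → ℝ :=
  fun ω => (X ω - ∫ ω', X ω' ∂P) / √(variance X P)

/-!
Write `μ n` and `v n` for the mean and the variance of `Y n`, and `h n = 1 + H n` with the harmonic
number `H n`, so that `h n ~ ln n`.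

**Election time.** One round at least halves the expected number of active processors in excess of
one, and at most doubles the expectation of `1 / (number of active processors + 1)`
(`integral_card_roundStep_le`, `integral_inv_card_roundStep_le`). By Markov's inequality the
election time has geometric tails on both sides of `log₂ n`, so that `b n - log₂ n` is bounded in
`L³`.

**Mean and variance.** If `x n` is the average of its predecessors plus a toll `t n`, then
`x n - t n` grows by `t n / (n + 1)` (`sub_toll_succ`). Applied to `μ`, with toll `𝔼 b n`, this
gives `|μ n - μ i| = O(h n (1 + H n - H i))`. The centred variables satisfy
`Y n - μ n = (Y (I n) - μ (I n)) + Z` in law, with `Z = b n - μ n + μ (I n)`, and `v` has the toll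
`𝔼 Z²`. As `H n - H (I n)` has bounded third moment, `𝔼 |Z|³ = O(h n ^ 3)`. Conversely
`𝔼 Z² ≥ c h n ^ 2`, because `μ n - μ (I n)` varies by the order of `ln n` whereas `b n - log₂ n`
is bounded in `L²`; this needs no assumption on the joint law of `I n` and `b n`. Hence `v n` is
at least of order `h n ^ 3`.

**Gaussian comparison.** Let `f` have a `1`-Lipschitz second derivative, and let `d n` bound
`|𝔼 f (Y n - μ n) - 𝔼 f (N (0, v n))|` over all such `f`. Conditionally on `(I n, b n)`, replacing
`Y (I n) - μ (I n)` by a Gaussian variable costs `d (I n)`. Then `𝔼 f (N (0, v (I n)) + Z)` is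
expanded around `Z = 0` and the variance `v n` (`exists_gaussian_expansion`). The terms of first
and second order cancel, since `𝔼 Z = 0` and `v n = 𝔼 v (I n) + 𝔼 Z²`, and the remainder is
`O(𝔼 |Z|³ + 𝔼 |v n - v (I n)|^(3/2)) = O(h n ^ 3)`. So `d n` is at most the average of the
preceding `d i` plus `K h n ^ 3`, and as the average of `h i ^ 4` is at most `h n ^ 4 - h n ^ 3`,
`d n ≤ K h n ^ 4` follows by induction. Rescaling to unit variance divides by
`v n ^ (3/2) ≥ c' h n ^ (9/2)`, which leaves `O(1 / √(ln n))`.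
-/

open scoped NNReal

/-! ### One round of leader election -/

theorem survivors_congr {n : ℕ} {toss toss' : ℕ → Fin n → Bool} {t : ℕ}
    (h : ∀ s < t, toss s = toss' s) : survivors toss t = survivors toss' t := by
  induction t with
  | zero => rfl
  | succ t ih =>
    have h1 := ih fun s hs => h s (by omega)
    simp only [survivors, h1, h t (by omega)]

theorem survivors_nonempty {n : ℕ} (hn : 1 ≤ n) (toss : ℕ → Fin n → Bool) (t : ℕ) :
    (survivors toss t).Nonempty := by
  induction t with
  | zero => exact ⟨⟨0, hn⟩, Finset.mem_univ _⟩
  | succ t ih =>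
    rw [survivors]
    split_ifs with h
    · exact h
    · exact ih

theorem survivors_antitone {n : ℕ} (toss : ℕ → Fin n → Bool) : Antitone (survivors toss) := by
  refine antitone_nat_of_succ_le fun t => ?_
  rw [survivors]
  split_ifs with h
  · exact Finset.filter_subset _ _
  · exact le_rfl

theorem electionTime_le_of_card_le {n : ℕ} {toss : ℕ → Fin n → Bool} {t : ℕ}
    (h : (survivors toss t).card ≤ 1) : electionTime toss ≤ t :=
  Nat.sInf_le h

theorem card_survivors_le_of_electionTime_le {n : ℕ} {toss : ℕ → Fin n → Bool} {t : ℕ}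
    (hne : ∃ s, (survivors toss s).card ≤ 1) (h : electionTime toss ≤ t) :
    (survivors toss t).card ≤ 1 :=
  (Finset.card_le_card (survivors_antitone toss h)).trans
    (Nat.sInf_mem (s := {t | (survivors toss t).card ≤ 1}) hne)

/-- Under fair tosses the set of heads within `S` is a uniform random subset of `S`. -/
theorem sum_filter_heads {n : ℕ} (S : Finset (Fin n)) (g : Finset (Fin n) → ℝ) :
    ∑ w : Fin n → Bool, g (S.filter fun p => w p = true) =
      2 ^ (n - S.card) * ∑ T ∈ S.powerset, g T := by
  have h1 : ∑ w : Fin n → Bool, g (S.filter fun p => w p = true) =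
      ∑ q ∈ S.powerset ×ˢ Sᶜ.powerset, g q.1 := by
    refine Finset.sum_nbij'
      (fun w => (S.filter fun p => w p = true, Sᶜ.filter fun p => w p = true))
      (fun q p => decide (p ∈ q.1 ∪ q.2)) ?_ ?_ ?_ ?_ ?_
    · intro w _
      simp [Finset.filter_subset]
    · intro q _
      exact Finset.mem_univ _
    · intro w _
      funext p
      by_cases hp : p ∈ S <;> simp [hp]
    · rintro ⟨T, V⟩ hq
      simp only [Finset.mem_product, Finset.mem_powerset] at hq
      ext p
      · have := @hq.1 p
        have h2 := @hq.2 p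
        simp only [Finset.mem_compl] at h2
        simp only [Finset.mem_filter, decide_eq_true_eq, Finset.mem_union]
        tauto
      · have := @hq.1 p
        have h2 := @hq.2 p
        simp only [Finset.mem_compl] at h2
        simp only [Finset.mem_filter, decide_eq_true_eq, Finset.mem_union, Finset.mem_compl]
        tauto
    · intro w _
      rfl
  rw [h1, Finset.sum_product]
  simp [Finset.card_powerset, Finset.card_compl, ← Finset.mul_sum]

theorem integral_fairCoin_pi {n : ℕ} (g : (Fin n → Bool) → ℝ) :
    ∫ w, g w ∂(Measure.pi fun _ : Fin n => fairCoin) = (2 ^ n)⁻¹ * ∑ w, g w := by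
  have h (w : Fin n → Bool) : (Measure.pi fun _ : Fin n => fairCoin).real {w} = (2 ^ n)⁻¹ := by
    rw [measureReal_def, Measure.pi_singleton]
    simp [fairCoin]
  rw [integral_fintype Integrable.of_finite]
  simp [h, Finset.mul_sum]

/-- The survivors of one round with tosses `w` among the active processors `S`. -/
def roundStep {n : ℕ} (S : Finset (Fin n)) (w : Fin n → Bool) : Finset (Fin n) :=
  if (S.filter fun p => w p = true).Nonempty then S.filter fun p => w p = true else S

theorem integral_heads {n : ℕ} (S : Finset (Fin n)) (g : Finset (Fin n) → ℝ) :
    ∫ w, g (S.filter fun p => w p = true) ∂(Measure.pi fun _ : Fin n => fairCoin) =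
      (2 ^ S.card)⁻¹ * ∑ T ∈ S.powerset, g T := by
  have hc : S.card ≤ n := by simpa using S.card_le_univ
  rw [integral_fairCoin_pi, sum_filter_heads, ← mul_assoc]
  congr 1
  have : (2 : ℝ) ^ n = 2 ^ (n - S.card) * 2 ^ S.card := by
    rw [← pow_add]; congr 1; omega
  rw [this]
  field_simp

/-- Pair each subset with its complement. -/
theorem two_mul_sum_powerset_card {α : Type*} [DecidableEq α] (S : Finset α) :
    2 * ∑ T ∈ S.powerset, (T.card : ℝ) = S.card * 2 ^ S.card := by
  have h : ∑ T ∈ S.powerset, (T.card : ℝ) = ∑ T ∈ S.powerset, ((S \ T).card : ℝ) := by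
    refine Finset.sum_nbij' (fun T => S \ T) (fun T => S \ T) ?_ ?_ ?_ ?_ ?_
    · intro T _; simp
    · intro T _; simp
    · intro T hT; simpa using hT
    · intro T hT; simpa using hT
    · intro T hT
      rw [Finset.sdiff_sdiff_eq_self (by simpa using hT)]
  rw [two_mul]
  nth_rewrite 2 [h]
  rw [← Finset.sum_add_distrib, Finset.sum_congr rfl (g := fun _ => (S.card : ℝ))]
  · simp [mul_comm]
  · intro T hT
    rw [← Nat.cast_add, Finset.card_sdiff_of_subset (by simpa using hT),
      Nat.add_sub_cancel' (Finset.card_le_card (by simpa using hT))]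

theorem sum_powerset_inv_card_add_one {α : Type*} (S : Finset α) :
    ∑ T ∈ S.powerset, ((T.card : ℝ) + 1)⁻¹ ≤ 2 * 2 ^ S.card * ((S.card : ℝ) + 1)⁻¹ := by
  rw [Finset.sum_powerset_apply_card (fun k => ((k : ℝ) + 1)⁻¹)]
  set m := S.card
  have h : ∀ k ∈ Finset.range (m + 1), m.choose k • ((k : ℝ) + 1)⁻¹ =
      ((m + 1).choose (k + 1) : ℝ) * ((m : ℝ) + 1)⁻¹ := by
    intro k _
    have := Nat.add_one_mul_choose_eq m k
    have h2 : ((m : ℝ) + 1) * m.choose k = (m + 1).choose (k + 1) * (k + 1) := by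
      exact_mod_cast this
    rw [nsmul_eq_mul]
    field_simp
    linarith
  rw [Finset.sum_congr rfl h, ← Finset.sum_mul]
  gcongr
  have h3 := Nat.sum_range_choose (m + 1)
  rw [Finset.sum_range_succ'] at h3
  have h4 : ∑ k ∈ Finset.range (m + 1), ((m + 1).choose (k + 1) : ℝ) + 1 = 2 ^ (m + 1) := by
    exact_mod_cast h3
  rw [pow_succ] at h4
  linarith

/-- In one round the expected number of processors in excess of one is at least halved. -/
theorem integral_card_roundStep_le {n : ℕ} {S : Finset (Fin n)} (hS : S.Nonempty) :
    ∫ w, (((roundStep S w).card : ℝ) - 1) ∂(Measure.pi fun _ : Fin n => fairCoin) ≤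
      2⁻¹ * ((S.card : ℝ) - 1) := by
  have h : ∀ w : Fin n → Bool, (((roundStep S w).card : ℝ) - 1) =
      (fun T : Finset (Fin n) => (T.card : ℝ) - 1 + if T = ∅ then (S.card : ℝ) else 0)
        (S.filter fun p => w p = true) := by
    intro w
    simp only [roundStep, Finset.nonempty_iff_ne_empty]
    by_cases h : (S.filter fun p => w p = true) = ∅
    · simp only [h, if_true, ne_eq, not_true_eq_false, if_false]; simp; ring
    · simp [h]
  rw [integral_congr_ae (.of_forall h), integral_heads S
    (fun T : Finset (Fin n) => (T.card : ℝ) - 1 + if T = ∅ then (S.card : ℝ) else 0)]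
  simp only [Finset.sum_add_distrib, Finset.sum_sub_distrib]
  have h1 := two_mul_sum_powerset_card S
  have h2 : ∑ T ∈ S.powerset, (if T = ∅ then (S.card : ℝ) else 0) = S.card := by
    simp [Finset.sum_ite_eq']
  have h3 : ∑ T ∈ S.powerset, (1 : ℝ) = 2 ^ S.card := by simp
  rw [h2, h3]
  have h4 : 2 * (S.card : ℝ) ≤ 2 ^ S.card := by
    have : 2 * S.card ≤ 2 ^ S.card := by
      obtain ⟨k, hk⟩ : ∃ k, S.card = k + 1 := ⟨S.card - 1, by have := hS.card_pos; omega⟩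
      have := Nat.lt_two_pow_self (n := k)
      rw [hk, pow_succ]; omega
    exact_mod_cast this
  rw [inv_mul_le_iff₀ (by positivity)]
  nlinarith

/-- In one round the expectation of `1 / (number of active processors + 1)` is at most doubled. -/
theorem integral_inv_card_roundStep_le {n : ℕ} (S : Finset (Fin n)) :
    ∫ w, (((roundStep S w).card : ℝ) + 1)⁻¹ ∂(Measure.pi fun _ : Fin n => fairCoin) ≤
      2 * ((S.card : ℝ) + 1)⁻¹ := by
  have h1 : ∫ w, (((roundStep S w).card : ℝ) + 1)⁻¹ ∂(Measure.pi fun _ : Fin n => fairCoin) ≤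
      ∫ w, (fun T : Finset (Fin n) => ((T.card : ℝ) + 1)⁻¹) (S.filter fun p => w p = true)
        ∂(Measure.pi fun _ : Fin n => fairCoin) := by
    refine integral_mono Integrable.of_finite Integrable.of_finite fun w => ?_
    simp only [roundStep]
    gcongr
    split_ifs
    · exact le_rfl
    · exact Finset.filter_subset _ _
  refine h1.trans ?_
  rw [integral_heads S (fun T => ((T.card : ℝ) + 1)⁻¹), inv_mul_le_iff₀ (by positivity)]
  have := sum_powerset_inv_card_add_one S
  linarith

/-! ### The tails of the election time -/

/-- The distribution of all the tosses of the leader election among `n` processors. -/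
noncomputable abbrev tossLaw (n : ℕ) : Measure (ℕ → Fin n → Bool) :=
  Measure.infinitePi fun _ : ℕ => Measure.pi fun _ : Fin n => fairCoin

/-- A sequence of tosses that agrees with `x` in the first `t` rounds. -/
def extendTosses {n t : ℕ} (x : Finset.range t → Fin n → Bool) : ℕ → Fin n → Bool :=
  fun s => if h : s ∈ Finset.range t then x ⟨s, h⟩ else fun _ => false

theorem survivors_extendTosses {n : ℕ} (t : ℕ) (toss : ℕ → Fin n → Bool) :
    survivors (extendTosses fun i : Finset.range t => toss i) t = survivors toss t :=
  survivors_congr fun s hs => by simp [extendTosses, hs]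

theorem survivors_succ {n : ℕ} (toss : ℕ → Fin n → Bool) (t : ℕ) :
    survivors toss (t + 1) = roundStep (survivors toss t) (toss t) := rfl

/-- The tosses of round `t` are independent of the survivors up to then. -/
theorem integral_survivors_succ {n : ℕ} (t : ℕ) (g : Finset (Fin n) → ℝ) :
    ∫ toss, g (survivors toss (t + 1)) ∂tossLaw n =
      ∫ toss, (∫ w, g (roundStep (survivors toss t) w) ∂(Measure.pi fun _ : Fin n => fairCoin))
        ∂tossLaw n := by
  have hind : IndepFun (fun (toss : ℕ → Fin n → Bool) (i : Finset.range t) => toss i)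
      (fun toss => toss t) (tossLaw n) := by
    have h0 : iIndepFun (fun (i : ℕ) (toss : ℕ → Fin n → Bool) => toss i) (tossLaw n) :=
      iIndepFun_infinitePi (X := fun _ w => w) fun _ => measurable_id
    have h1 := h0.indepFun_finset (Finset.range t) {t} (by simp) fun i => measurable_pi_apply i
    exact h1.comp (φ := id) (ψ := fun x : (({t} : Finset ℕ) → Fin n → Bool) => x ⟨t, by simp⟩)
      measurable_id (measurable_pi_apply _)
  have hm1 : Measurable fun (toss : ℕ → Fin n → Bool) (i : Finset.range t) => toss i := by fun_prop
  have hm2 : Measurable fun toss : ℕ → Fin n → Bool => toss t := by fun_prop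
  have hmap := (indepFun_iff_map_prod_eq_prod_map_map hm1.aemeasurable hm2.aemeasurable).1 hind
  have hlaw : (tossLaw n).map (fun toss => toss t) = Measure.pi fun _ : Fin n => fairCoin :=
    Measure.infinitePi_map_eval _ t
  set G : (Finset.range t → Fin n → Bool) × (Fin n → Bool) → ℝ :=
    fun q => g (roundStep (survivors (extendTosses q.1) t) q.2) with hG
  have hGm : Measurable G := measurable_of_countable _
  have := Measure.isProbabilityMeasure_map (μ := tossLaw n) hm1.aemeasurable
  calc ∫ toss, g (survivors toss (t + 1)) ∂tossLaw n
      = ∫ toss, G (fun i : Finset.range t => toss i, toss t) ∂tossLaw n := by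
        simp only [hG, survivors_extendTosses, survivors_succ]
    _ = ∫ q, G q ∂(((tossLaw n).map fun toss (i : Finset.range t) => toss i).prod
          (Measure.pi fun _ : Fin n => fairCoin)) := by
        rw [← hlaw, ← hmap, integral_map (hm1.prodMk hm2).aemeasurable hGm.aestronglyMeasurable]
    _ = ∫ toss, (∫ w, G (fun i : Finset.range t => toss i, w)
          ∂(Measure.pi fun _ : Fin n => fairCoin)) ∂tossLaw n := by
        rw [integral_prod _ Integrable.of_finite, integral_map hm1.aemeasurable
          (measurable_of_countable _).aestronglyMeasurable]
    _ = _ := by simp only [hG, survivors_extendTosses]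

theorem measurable_comp_survivors {n : ℕ} (t : ℕ) {β : Type*} [MeasurableSpace β]
    (g : Finset (Fin n) → β) :
    Measurable fun toss : ℕ → Fin n → Bool => g (survivors toss t) := by
  have h : Measurable fun x : (Finset.range t → Fin n → Bool) =>
    g (survivors (extendTosses x) t) := measurable_of_countable _
  have hm1 : Measurable fun (toss : ℕ → Fin n → Bool) (i : Finset.range t) => toss i := by fun_prop
  have := h.comp hm1
  simpa only [Function.comp_def, survivors_extendTosses] using this

theorem integrable_comp_survivors {n : ℕ} (t : ℕ) (g : Finset (Fin n) → ℝ) :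
    Integrable (fun toss => g (survivors toss t)) (tossLaw n) := by
  refine Integrable.of_bound (measurable_comp_survivors t g).aestronglyMeasurable
    (∑ S, ‖g S‖) (.of_forall fun toss => ?_)
  exact Finset.single_le_sum (f := fun S => ‖g S‖) (fun _ _ => norm_nonneg _) (Finset.mem_univ _)

theorem integral_card_survivors_le {n : ℕ} (hn : 1 ≤ n) (t : ℕ) :
    ∫ toss, (((survivors toss t).card : ℝ) - 1) ∂tossLaw n ≤ 2⁻¹ ^ t * ((n : ℝ) - 1) := by
  induction t with
  | zero => simp [survivors]
  | succ t ih =>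
    rw [integral_survivors_succ t fun S => (S.card : ℝ) - 1]
    calc _ ≤ ∫ toss, 2⁻¹ * (((survivors toss t).card : ℝ) - 1) ∂tossLaw n := by
          refine integral_mono (integrable_comp_survivors t fun S =>
            ∫ w, (((roundStep S w).card : ℝ) - 1) ∂(Measure.pi fun _ : Fin n => fairCoin))
            (integrable_comp_survivors t fun S => 2⁻¹ * ((S.card : ℝ) - 1)) fun toss => ?_
          exact integral_card_roundStep_le (survivors_nonempty hn toss t)
      _ ≤ _ := by
          rw [integral_const_mul, pow_succ]
          linarith

theorem integral_inv_card_survivors_le {n : ℕ} (t : ℕ) :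
    ∫ toss, (((survivors toss t).card : ℝ) + 1)⁻¹ ∂tossLaw n ≤ 2 ^ t * ((n : ℝ) + 1)⁻¹ := by
  induction t with
  | zero => simp [survivors]
  | succ t ih =>
    rw [integral_survivors_succ t fun S => ((S.card : ℝ) + 1)⁻¹]
    calc _ ≤ ∫ toss, 2 * (((survivors toss t).card : ℝ) + 1)⁻¹ ∂tossLaw n := by
          refine integral_mono (integrable_comp_survivors t fun S =>
            ∫ w, (((roundStep S w).card : ℝ) + 1)⁻¹ ∂(Measure.pi fun _ : Fin n => fairCoin))
            (integrable_comp_survivors t fun S => 2 * ((S.card : ℝ) + 1)⁻¹) fun toss => ?_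
          exact integral_inv_card_roundStep_le _
      _ ≤ _ := by
          rw [integral_const_mul, pow_succ]
          linarith

theorem measureReal_one_lt_card_survivors_le {n : ℕ} (hn : 1 ≤ n) (t : ℕ) :
    (tossLaw n).real {toss | 1 < (survivors toss t).card} ≤ 2⁻¹ ^ t * (n : ℝ) := by
  have hms : MeasurableSet {toss : ℕ → Fin n → Bool | 1 < (survivors toss t).card} :=
    measurable_comp_survivors t (fun S => S.card) (measurableSet_Ioi (a := 1))
  rw [← integral_indicator_one hms]
  refine (integral_mono ((integrable_const 1).indicator hms)
    (integrable_comp_survivors t fun S => (S.card : ℝ) - 1) fun toss => ?_).trans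
    ((integral_card_survivors_le hn t).trans ?_)
  · by_cases h : 1 < (survivors toss t).card
    · have : (2 : ℝ) ≤ (survivors toss t).card := by exact_mod_cast h
      simp only [Set.indicator, Set.mem_ofPred_eq, h, if_true, Pi.one_apply]
      linarith
    · have : (1 : ℝ) ≤ (survivors toss t).card := by
        exact_mod_cast (survivors_nonempty hn toss t).card_pos
      simp only [Set.indicator, Set.mem_ofPred_eq, h, if_false]
      linarith
  · gcongr
    linarith

theorem measureReal_card_survivors_le_one_le {n : ℕ} (t : ℕ) :
    (tossLaw n).real {toss | (survivors toss t).card ≤ 1} ≤ 2 * (2 ^ t * ((n : ℝ) + 1)⁻¹) := by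
  have hms : MeasurableSet {toss : ℕ → Fin n → Bool | (survivors toss t).card ≤ 1} :=
    measurable_comp_survivors t (fun S => S.card) (measurableSet_Iic (a := 1))
  rw [← integral_indicator_one hms]
  refine (integral_mono ((integrable_const 1).indicator hms)
    (integrable_comp_survivors t fun S => 2 * ((S.card : ℝ) + 1)⁻¹) fun toss => ?_).trans ?_
  · by_cases h : (survivors toss t).card ≤ 1
    · have : ((survivors toss t).card : ℝ) ≤ 1 := by exact_mod_cast h
      simp only [Set.indicator, Set.mem_ofPred_eq, h, if_true, Pi.one_apply]
      rw [← div_eq_mul_inv, le_div_iff₀ (by positivity)]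
      linarith
    · simp only [Set.indicator, Set.mem_ofPred_eq, h, if_false]
      positivity
  · rw [integral_const_mul]
    have := integral_inv_card_survivors_le (n := n) t
    linarith

/-- Almost surely the election ends. -/
theorem ae_exists_card_survivors_le_one {n : ℕ} (hn : 1 ≤ n) :
    ∀ᵐ toss ∂tossLaw n, ∃ s, (survivors toss s).card ≤ 1 := by
  rw [ae_iff, ← measureReal_eq_zero_iff]
  refine le_antisymm ?_ measureReal_nonneg
  have hl : Tendsto (fun t : ℕ => (2⁻¹ : ℝ) ^ t * (n : ℝ)) atTop (nhds (0 * n)) :=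
    (tendsto_pow_atTop_nhds_zero_of_lt_one (by norm_num) (by norm_num)).mul_const _
  rw [zero_mul] at hl
  refine ge_of_tendsto' hl fun t => ?_
  refine le_trans (measureReal_mono ?_) (measureReal_one_lt_card_survivors_le hn t)
  intro toss h
  simp only [Set.mem_ofPred_eq, not_exists, not_le] at h ⊢
  exact h t

instance (n : ℕ) : IsProbabilityMeasure (electionLaw n) :=
  Measure.isProbabilityMeasure_map (measurable_electionTime n).aemeasurable

theorem electionLaw_real_eq {n : ℕ} (s : Set ℕ) :
    (electionLaw n).real s = (tossLaw n).real (electionTime ⁻¹' s) :=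
  map_measureReal_apply (measurable_electionTime n) (Set.to_countable s).measurableSet

theorem electionLaw_real_Ioi_le {n : ℕ} (hn : 1 ≤ n) (t : ℕ) :
    (electionLaw n).real (Set.Ioi t) ≤ 2⁻¹ ^ t * (n : ℝ) := by
  rw [electionLaw_real_eq]
  refine le_trans (measureReal_mono fun toss h => ?_) (measureReal_one_lt_card_survivors_le hn t)
  simp only [Set.mem_preimage, Set.mem_Ioi, Set.mem_ofPred_eq] at h ⊢
  by_contra h2
  exact absurd (electionTime_le_of_card_le (not_lt.1 h2)) (not_le.2 h)

/-- If the election never ended, `electionTime` would be `0`, which is why the bound needs that it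
ends almost surely. -/
theorem electionLaw_real_Iic_le {n : ℕ} (hn : 1 ≤ n) (t : ℕ) :
    (electionLaw n).real (Set.Iic t) ≤ 2 * (2 ^ t * ((n : ℝ) + 1)⁻¹) := by
  rw [electionLaw_real_eq]
  refine le_trans ?_ (measureReal_card_survivors_le_one_le t)
  refine ENNReal.toReal_mono (measure_ne_top _ _) (measure_mono_ae ?_)
  filter_upwards [ae_exists_card_survivors_le_one hn] with toss hne h
  exact card_survivors_le_of_electionTime_le hne h

/-- The election time is concentrated around `log₂ n` with geometric tails. -/
theorem electionLaw_real_singleton_le {n : ℕ} (hn : 1 ≤ n) (k : ℕ) :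
    (electionLaw n).real {k} ≤ 4 * 2⁻¹ ^ ((k : ℤ) - Nat.log 2 n).natAbs := by
  set κ := Nat.log 2 n with hκ
  have hκ1 : 2 ^ κ ≤ n := Nat.pow_log_le_self 2 (by omega)
  have hκ2 : n < 2 ^ (κ + 1) := Nat.lt_pow_succ_log_self (by norm_num) n
  have hκ1r : (2 : ℝ) ^ κ ≤ n := by exact_mod_cast hκ1
  have hκ2r : (n : ℝ) ≤ 2 ^ κ * 2 := by rw [← pow_succ]; exact_mod_cast hκ2.le
  rcases le_total k κ with h | h
  · obtain ⟨d, hd⟩ := Nat.exists_eq_add_of_le h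
    have : ((k : ℤ) - κ).natAbs = d := by omega
    rw [this]
    refine (measureReal_mono (s₂ := Set.Iic k) (by simp)).trans
      ((electionLaw_real_Iic_le hn k).trans ?_)
    have h1 : ((n : ℝ) + 1)⁻¹ ≤ (2 ^ κ)⁻¹ := by gcongr; linarith
    calc 2 * ((2 : ℝ) ^ k * ((n : ℝ) + 1)⁻¹) ≤ 2 * (2 ^ k * (2 ^ κ)⁻¹) := by gcongr
      _ = 2 * 2⁻¹ ^ d := by rw [hd, pow_add, inv_pow]; field_simp
      _ ≤ _ := by gcongr; norm_num
  · obtain ⟨d, hd⟩ := Nat.exists_eq_add_of_le h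
    have : ((k : ℤ) - κ).natAbs = d := by omega
    rw [this]
    rcases Nat.eq_zero_or_pos k with h0 | h0
    · have : d = 0 := by omega
      rw [this]
      exact measureReal_le_one.trans (by norm_num)
    obtain ⟨j, rfl⟩ : ∃ j, k = j + 1 := ⟨k - 1, by omega⟩
    refine (measureReal_mono (s₂ := Set.Ioi j) (by simp)).trans
      ((electionLaw_real_Ioi_le hn j).trans ?_)
    have h2 : (2⁻¹ : ℝ) ^ j = 2 * 2⁻¹ ^ (j + 1) := by rw [pow_succ]; ring
    calc (2⁻¹ : ℝ) ^ j * n ≤ 2⁻¹ ^ j * (2 ^ κ * 2) := by gcongr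
      _ = 4 * (2⁻¹ ^ κ * 2 ^ κ) * 2⁻¹ ^ d := by rw [h2, hd, pow_add]; ring
      _ = _ := by rw [← mul_pow]; norm_num

theorem tsum_int_natAbs_pow_mul_geometric_ne_top :
    ∑' j : ℤ, ENNReal.ofReal ((j.natAbs : ℝ) ^ 3 * (4 * 2⁻¹ ^ j.natAbs)) ≠ ∞ := by
  have h : Summable fun j : ℕ => (j : ℝ) ^ 3 * (4 * 2⁻¹ ^ j) := by
    have := (summable_pow_mul_geometric_of_norm_lt_one 3 (r := (2⁻¹ : ℝ)) (by norm_num)).mul_left 4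
    refine this.congr fun j => by ring
  have h2 : Summable fun j : ℤ => ((j.natAbs : ℝ) ^ 3 * (4 * 2⁻¹ ^ j.natAbs)) :=
    Summable.of_nat_of_neg (by simpa using h) (by simpa using h)
  exact h2.tsum_ofReal_ne_top

/-- The third absolute moment of the election time around `log₂ n` is bounded. -/
theorem exists_electionLaw_moment_le : ∃ C : ℝ, 0 ≤ C ∧ ∀ n, 1 ≤ n →
    ∫⁻ k, ENNReal.ofReal (|(k : ℝ) - Nat.log 2 n| ^ 3) ∂electionLaw n ≤ ENNReal.ofReal C := by
  refine ⟨(∑' j : ℤ, ENNReal.ofReal ((j.natAbs : ℝ) ^ 3 * (4 * 2⁻¹ ^ j.natAbs))).toReal,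
    ENNReal.toReal_nonneg, fun n hn => ?_⟩
  rw [ENNReal.ofReal_toReal tsum_int_natAbs_pow_mul_geometric_ne_top, lintegral_countable']
  calc _ ≤ ∑' k : ℕ, (fun j : ℤ => ENNReal.ofReal ((j.natAbs : ℝ) ^ 3 * (4 * 2⁻¹ ^ j.natAbs)))
          ((k : ℤ) - Nat.log 2 n) := by
        refine ENNReal.tsum_le_tsum fun k => ?_
        have h1 : electionLaw n {k} = ENNReal.ofReal ((electionLaw n).real {k}) := by
          rw [ofReal_measureReal]
        have h2 : |(k : ℝ) - Nat.log 2 n| = (((k : ℤ) - Nat.log 2 n).natAbs : ℝ) := by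
          rw [Nat.cast_natAbs]; push_cast; rfl
        rw [h1, ← ENNReal.ofReal_mul (by positivity), h2]
        refine ENNReal.ofReal_le_ofReal ?_
        gcongr
        exact electionLaw_real_singleton_le hn k
    _ ≤ _ := ENNReal.tsum_comp_le_tsum_of_injective
        (f := fun k : ℕ => (k : ℤ) - Nat.log 2 n) (fun a b h => by simpa using h) _

/-! ### Taylor expansion of the test functions -/

/-- A function `f` of the Zolotarev class together with its derivatives `f'` and `f''`. -/
structure IsZolotarevTest (f f' f'' : ℝ → ℝ) : Prop where
  hasDerivAt : ∀ x, HasDerivAt f (f' x) x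
  hasDerivAt' : ∀ x, HasDerivAt f' (f'' x) x
  lipschitz : ∀ x y, |f'' x - f'' y| ≤ |x - y|

theorem isZolotarevTest_of_mem {f : ℝ → ℝ} (hf : f ∈ zolotarevClass) :
    IsZolotarevTest f (deriv f) (deriv (deriv f)) := by
  obtain ⟨h1, h2⟩ := hf
  have h3 : ContDiff ℝ 1 (deriv f) := by
    have : ContDiff ℝ (1 + 1) f := by simpa [one_add_one_eq_two] using h1
    exact (contDiff_succ_iff_deriv.1 this).2.2
  refine ⟨fun x => (h1.differentiable (by norm_num) x).hasDerivAt,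
    fun x => (h3.differentiable (by norm_num) x).hasDerivAt, fun x y => ?_⟩
  simpa [iteratedDeriv_succ, iteratedDeriv_zero] using h2 x y

/-- If a function vanishes at `0` and its derivative is at most `c` on `[-|w|, |w|]`, it is at most
`c |w|` at `w`. -/
theorem abs_le_of_hasDerivAt_of_abs_le {g g' : ℝ → ℝ} {w c : ℝ} (h0 : g 0 = 0)
    (hg : ∀ y, HasDerivAt g (g' y) y) (hc : ∀ y, |y| ≤ |w| → |g' y| ≤ c) : |g w| ≤ c * |w| := by
  have := (convex_Icc (-|w|) |w|).norm_image_sub_le_of_norm_hasDerivWithin_le (f := g) (f' := g')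
    (C := c) (x := 0) (y := w) (fun y _ => (hg y).hasDerivWithinAt)
    (fun y hy => hc y (abs_le.2 hy)) (Set.mem_Icc.2 ⟨by simp, by simp⟩)
    (Set.mem_Icc.2 (abs_le.1 le_rfl))
  simpa [h0] using this

namespace IsZolotarevTest

variable {f f' f'' : ℝ → ℝ}

theorem abs_deriv_taylor_le (hf : IsZolotarevTest f f' f'') (x w : ℝ) :
    |f' (x + w) - f' x - f'' x * w| ≤ |w| ^ 2 := by
  rw [pow_two]
  refine abs_le_of_hasDerivAt_of_abs_le (g := fun w => f' (x + w) - f' x - f'' x * w)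
    (g' := fun w => f'' (x + w) - f'' x) (by simp) (fun y => ?_) fun y hy => ?_
  · have h1 := (((hf.hasDerivAt' (x + y)).comp_const_add x y).sub_const (f' x)).sub
      ((hasDerivAt_id y).const_mul (f'' x))
    convert! h1 using 1
    simp
  · exact (hf.lipschitz _ _).trans (by simpa using hy)

theorem abs_taylor_le (hf : IsZolotarevTest f f' f'') (x w : ℝ) :
    |f (x + w) - f x - f' x * w - f'' x * w ^ 2 / 2| ≤ |w| ^ 3 := by
  rw [pow_succ]
  refine abs_le_of_hasDerivAt_of_abs_le
    (g := fun w => f (x + w) - f x - f' x * w - f'' x * w ^ 2 / 2)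
    (g' := fun w => f' (x + w) - f' x - f'' x * w) (by simp) (fun y => ?_) fun y hy => ?_
  · have h1 := ((((hf.hasDerivAt (x + y)).comp_const_add x y).sub_const (f x)).sub
      ((hasDerivAt_id y).const_mul (f' x))).sub
      ((((hasDerivAt_id y).pow 2).const_mul (f'' x)).div_const 2)
    convert! h1 using 1
    simp
    ring
  · exact (hf.abs_deriv_taylor_le x y).trans (pow_le_pow_left₀ (abs_nonneg y) hy 2)

theorem translate (hf : IsZolotarevTest f f' f'') (c : ℝ) :
    IsZolotarevTest (fun x => f (x + c)) (fun x => f' (x + c)) (fun x => f'' (x + c)) where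
  hasDerivAt x := (hf.hasDerivAt (x + c)).comp_add_const x c
  hasDerivAt' x := (hf.hasDerivAt' (x + c)).comp_add_const x c
  lipschitz x y := by simpa using hf.lipschitz (x + c) (y + c)

/-- `ζ₃` is homogeneous of degree three. -/
theorem rescale (hf : IsZolotarevTest f f' f'') {s : ℝ} (hs : 0 < s) :
    IsZolotarevTest (fun x => s ^ 3 * f (x / s)) (fun x => s ^ 2 * f' (x / s))
      (fun x => s * f'' (x / s)) where
  hasDerivAt x := by
    have h := ((hf.hasDerivAt (x / s)).comp x ((hasDerivAt_id x).div_const s)).const_mul (s ^ 3)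
    convert! h using 1
    field_simp
  hasDerivAt' x := by
    have h := ((hf.hasDerivAt' (x / s)).comp x ((hasDerivAt_id x).div_const s)).const_mul (s ^ 2)
    convert! h using 1
    field_simp
  lipschitz x y := by
    rw [← mul_sub, abs_mul, abs_of_pos hs]
    calc s * |f'' (x / s) - f'' (y / s)| ≤ s * |x / s - y / s| := by
          exact mul_le_mul_of_nonneg_left (hf.lipschitz _ _) hs.le
      _ = |x - y| := by
          rw [← sub_div, abs_div, abs_of_pos hs]; field_simp

theorem continuous (hf : IsZolotarevTest f f' f'') : Continuous f :=
  continuous_iff_continuousAt.2 fun x => (hf.hasDerivAt x).continuousAt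

theorem continuous' (hf : IsZolotarevTest f f' f'') : Continuous f' :=
  continuous_iff_continuousAt.2 fun x => (hf.hasDerivAt' x).continuousAt

theorem continuous'' (hf : IsZolotarevTest f f' f'') : Continuous f'' :=
  (LipschitzWith.of_dist_le_mul (K := 1) fun x y => by
    simpa [Real.dist_eq] using hf.lipschitz x y).continuous

theorem exists_abs_le (hf : IsZolotarevTest f f' f'') :
    ∃ A, ∀ x, |f x| ≤ A * (1 + |x| ^ 3) ∧ |f' x| ≤ A * (1 + |x| ^ 3) ∧
      |f'' x| ≤ A * (1 + |x| ^ 3) := by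
  refine ⟨|f 0| + |f' 0| + |f'' 0| + 1, fun x => ?_⟩
  have h1 := hf.abs_taylor_le 0 x
  have h2 := hf.abs_deriv_taylor_le 0 x
  have h3 := hf.lipschitz x 0
  simp only [zero_add, sub_zero] at h1 h2 h3
  have hx := abs_nonneg x
  have e1 : |x| ≤ 1 + |x| ^ 3 := by nlinarith [sq_nonneg (|x| - 1)]
  have e2 : |x| ^ 2 ≤ 1 + |x| ^ 3 := by nlinarith [sq_nonneg (|x| - 1), mul_nonneg hx hx]
  have e3 : 1 ≤ 1 + |x| ^ 3 := by have := pow_nonneg hx 3; linarith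
  have p0 := abs_nonneg (f 0)
  have p1 := abs_nonneg (f' 0)
  have p2 := abs_nonneg (f'' 0)
  have q (a b : ℝ) (ha : 0 ≤ a) (hb : b ≤ 1 + |x| ^ 3) : a * b ≤ a * (1 + |x| ^ 3) := by gcongr
  refine ⟨?_, ?_, ?_⟩
  · have t : |f x| ≤ |x| ^ 3 + |f 0| + |f' 0| * |x| + |f'' 0| * |x| ^ 2 / 2 := by
      have e : f x = (f x - f 0 - f' 0 * x - f'' 0 * x ^ 2 / 2) + f 0 + f' 0 * x
        + f'' 0 * x ^ 2 / 2 := by ring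
      rw [e]
      refine (abs_add_le _ _).trans (add_le_add ((abs_add_le _ _).trans (add_le_add
        ((abs_add_le _ _).trans (add_le_add h1 le_rfl)) ?_)) ?_)
      · rw [abs_mul]
      · rw [abs_div, abs_mul, abs_pow]; simp
    nlinarith [q _ _ p0 e3, q _ _ p1 e1, q _ _ p2 e2, mul_nonneg p2 (sq_nonneg |x|)]
  · have t : |f' x| ≤ |x| ^ 2 + |f' 0| + |f'' 0| * |x| := by
      have e : f' x = (f' x - f' 0 - f'' 0 * x) + f' 0 + f'' 0 * x := by ring
      rw [e]
      refine (abs_add_le _ _).trans (add_le_add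
        ((abs_add_le _ _).trans (add_le_add h2 le_rfl)) ?_)
      rw [abs_mul]
    nlinarith [q _ _ p0 e3, q _ _ p1 e3, q _ _ p2 e1]
  · have t : |f'' x| ≤ |x| + |f'' 0| := by
      have e : f'' x = (f'' x - f'' 0) + f'' 0 := by ring
      rw [e]
      exact (abs_add_le _ _).trans (add_le_add h3 le_rfl)
    nlinarith [q _ _ p0 e3, q _ _ p1 e3, q _ _ p2 e3]

end IsZolotarevTest

/-- A function of cubic growth is integrable against laws with finite third moment. -/
theorem integrable_comp_of_memLp_three {Ω : Type*} [MeasurableSpace Ω] {P : Measure Ω}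
    [IsProbabilityMeasure P] {X : Ω → ℝ} (hX : MemLp X 3 P) {g : ℝ → ℝ} (hg : Continuous g) {A : ℝ}
    (hA : ∀ x, |g x| ≤ A * (1 + |x| ^ 3)) : Integrable (fun ω => g (X ω)) P := by
  have h3 : Integrable (fun ω => |X ω| ^ 3) P := by
    simpa using hX.integrable_norm_pow (p := 3) (by norm_num)
  refine Integrable.mono' (((integrable_const 1).add h3).const_mul A)
    (hg.comp_aestronglyMeasurable hX.aestronglyMeasurable) (.of_forall fun ω => hA _)

namespace IsZolotarevTest

variable {f f' f'' : ℝ → ℝ}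

theorem integrable_comp (hf : IsZolotarevTest f f' f'') {Ω : Type*} [MeasurableSpace Ω]
    {P : Measure Ω} [IsProbabilityMeasure P] {X : Ω → ℝ} (hX : MemLp X 3 P) :
    Integrable (fun ω => f (X ω)) P ∧ Integrable (fun ω => f' (X ω)) P ∧
      Integrable (fun ω => f'' (X ω)) P := by
  obtain ⟨A, hA⟩ := hf.exists_abs_le
  exact ⟨integrable_comp_of_memLp_three hX hf.continuous fun x => (hA x).1,
    integrable_comp_of_memLp_three hX hf.continuous' fun x => (hA x).2.1,
    integrable_comp_of_memLp_three hX hf.continuous'' fun x => (hA x).2.2⟩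

end IsZolotarevTest

/-! ### Replacing a Gaussian increment -/

theorem abs_integral_conv_sub_le {M ν : Measure ℝ} [IsProbabilityMeasure M]
    [IsProbabilityMeasure ν] {g G : ℝ → ℝ} {e : ℝ} (hg : Integrable g (M.conv ν))
    (hG : Integrable G M) (h : ∀ x, |∫ w, g (x + w) ∂ν - G x| ≤ e) :
    |∫ x, g x ∂(M.conv ν) - ∫ x, G x ∂M| ≤ e := by
  rw [integral_conv hg]
  have hi : Integrable (fun x => ∫ w, g (x + w) ∂ν) M := by
    have := (integrable_map_measure hg.1 (by fun_prop)).1 hg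
    exact this.integral_prod_left
  rw [← integral_sub hi hG]
  refine (abs_integral_le_integral_abs).trans ?_
  refine (integral_mono (hi.sub hG).abs (integrable_const e) h).trans (by simp)

section
variable {f f' f'' : ℝ → ℝ} {M ν : Measure ℝ} [IsProbabilityMeasure M] [IsProbabilityMeasure ν]

theorem integrable_abs_pow_of_memLp_three (hν : MemLp id 3 ν) :
    Integrable (fun w => w) ν ∧ Integrable (fun w => w ^ 2) ν ∧
      Integrable (fun w => |w| ^ 3) ν := by
  refine ⟨?_, ?_, ?_⟩
  · exact hν.integrable (by norm_num)
  · exact (hν.mono_exponent (p := 2) (by norm_num)).integrable_sq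
  · simpa using hν.integrable_norm_pow (p := 3) (by norm_num)

theorem memLp_three_const_add (hν : MemLp id 3 ν) (x : ℝ) : MemLp (fun w => x + w) 3 ν :=
  (memLp_const x).add hν

/-- Adding an independent increment with law `ν` changes the expectation of `f` by the Taylor
polynomial with the moments of `ν`. -/
theorem IsZolotarevTest.abs_integral_conv_le (hf : IsZolotarevTest f f' f'') (hM : MemLp id 3 M)
    (hν : MemLp id 3 ν) (hc : MemLp id 3 (M.conv ν)) :
    |∫ x, f x ∂(M.conv ν) - (∫ x, f x ∂M + (∫ w, w ∂ν) * ∫ x, f' x ∂M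
      + (∫ w, w ^ 2 ∂ν) / 2 * ∫ x, f'' x ∂M)| ≤ ∫ w, |w| ^ 3 ∂ν := by
  obtain ⟨i1, i2, i3⟩ := integrable_abs_pow_of_memLp_three hν
  obtain ⟨j0, j1, j2⟩ := hf.integrable_comp hM
  simp only [id] at j0 j1 j2
  have e : ∫ x, f x ∂M + (∫ w, w ∂ν) * ∫ x, f' x ∂M + (∫ w, w ^ 2 ∂ν) / 2 * ∫ x, f'' x ∂M =
      ∫ x, (f x + (∫ w, w ∂ν) * f' x + (∫ w, w ^ 2 ∂ν) / 2 * f'' x) ∂M := by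
    have l1 : Integrable (fun x => (∫ w, w ∂ν) * f' x) M := j1.const_mul _
    have l2 : Integrable (fun x => f x + (∫ w, w ∂ν) * f' x) M := j0.add l1
    rw [integral_add l2 (j2.const_mul _), integral_add j0 l1,
      integral_const_mul, integral_const_mul]
  rw [e]
  refine abs_integral_conv_sub_le (hf.integrable_comp hc).1
    ((j0.add (j1.const_mul _)).add (j2.const_mul _)) fun x => ?_
  have k0 := (hf.integrable_comp (memLp_three_const_add hν x)).1
  have e2 : ∫ w, f (x + w) ∂ν - (f x + (∫ w, w ∂ν) * f' x + (∫ w, w ^ 2 ∂ν) / 2 * f'' x) =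
      ∫ w, (f (x + w) - f x - f' x * w - f'' x * w ^ 2 / 2) ∂ν := by
    have l1 : Integrable (fun w => f (x + w) - f x) ν := k0.sub (integrable_const _)
    have l2 : Integrable (fun w => f (x + w) - f x - f' x * w) ν := l1.sub (i1.const_mul _)
    rw [integral_sub l2 ((i2.const_mul _).div_const _), integral_sub l1 (i1.const_mul _),
      integral_sub k0 (integrable_const _), integral_div, integral_const_mul, integral_const_mul]
    simp
    ring
  rw [e2]
  refine abs_integral_le_integral_abs.trans (integral_mono_of_nonneg
    (.of_forall fun w => abs_nonneg _) i3 (.of_forall fun w => hf.abs_taylor_le x w))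

theorem IsZolotarevTest.abs_integral_deriv_conv_le (hf : IsZolotarevTest f f' f'')
    (hM : MemLp id 3 M) (hν : MemLp id 3 ν) (hc : MemLp id 3 (M.conv ν)) :
    |∫ x, f' x ∂(M.conv ν) - (∫ x, f' x ∂M + (∫ w, w ∂ν) * ∫ x, f'' x ∂M)| ≤ ∫ w, w ^ 2 ∂ν := by
  obtain ⟨i1, i2, i3⟩ := integrable_abs_pow_of_memLp_three hν
  obtain ⟨j0, j1, j2⟩ := hf.integrable_comp hM
  simp only [id] at j0 j1 j2
  have e : ∫ x, f' x ∂M + (∫ w, w ∂ν) * ∫ x, f'' x ∂M =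
      ∫ x, (f' x + (∫ w, w ∂ν) * f'' x) ∂M := by
    rw [integral_add j1 (j2.const_mul _), integral_const_mul]
  rw [e]
  refine abs_integral_conv_sub_le (hf.integrable_comp hc).2.1
    (j1.add (j2.const_mul _)) fun x => ?_
  have k0 := (hf.integrable_comp (memLp_three_const_add hν x)).2.1
  have e2 : ∫ w, f' (x + w) ∂ν - (f' x + (∫ w, w ∂ν) * f'' x) =
      ∫ w, (f' (x + w) - f' x - f'' x * w) ∂ν := by
    have l1 : Integrable (fun w => f' (x + w) - f' x) ν := k0.sub (integrable_const _)
    rw [integral_sub l1 (i1.const_mul _), integral_sub k0 (integrable_const _),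
      integral_const_mul]
    simp
    ring
  rw [e2]
  refine abs_integral_le_integral_abs.trans (integral_mono_of_nonneg
    (.of_forall fun w => abs_nonneg _) i2 (.of_forall fun w => ?_))
  simpa using hf.abs_deriv_taylor_le x w

theorem IsZolotarevTest.abs_integral_deriv_deriv_conv_le (hf : IsZolotarevTest f f' f'')
    (hM : MemLp id 3 M) (hν : MemLp id 3 ν) (hc : MemLp id 3 (M.conv ν)) :
    |∫ x, f'' x ∂(M.conv ν) - ∫ x, f'' x ∂M| ≤ ∫ w, |w| ∂ν := by
  obtain ⟨i1, i2, i3⟩ := integrable_abs_pow_of_memLp_three hν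
  obtain ⟨j0, j1, j2⟩ := hf.integrable_comp hM
  simp only [id] at j0 j1 j2
  refine abs_integral_conv_sub_le (hf.integrable_comp hc).2.2 j2 fun x => ?_
  have k0 := (hf.integrable_comp (memLp_three_const_add hν x)).2.2
  have e2 : ∫ w, f'' (x + w) ∂ν - f'' x = ∫ w, (f'' (x + w) - f'' x) ∂ν := by
    rw [integral_sub k0 (integrable_const _)]
    simp
  rw [e2]
  refine abs_integral_le_integral_abs.trans (integral_mono_of_nonneg
    (.of_forall fun w => abs_nonneg _) i1.abs (.of_forall fun w => ?_))
  simpa using hf.lipschitz (x + w) x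

end

theorem memLp_three_gaussianReal (m : ℝ) (v : ℝ≥0) : MemLp id 3 (gaussianReal m v) :=
  memLp_id_gaussianReal' 3 (by norm_num)

theorem gaussianReal_eq_map (m : ℝ) (v : ℝ≥0) :
    gaussianReal m v = (gaussianReal 0 1).map fun x => m + √(v : ℝ) * x := by
  have h : (fun x : ℝ => m + √(v : ℝ) * x) = (m + ·) ∘ (√(v : ℝ) * ·) := rfl
  rw [h, ← Measure.map_map (by fun_prop) (by fun_prop), gaussianReal_map_const_mul,
    gaussianReal_map_const_add]
  congr 1
  · simp
  · ext; simp

theorem integral_gaussianReal_eq (m : ℝ) (v : ℝ≥0) {g : ℝ → ℝ} (hg : Continuous g) :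
    ∫ x, g x ∂gaussianReal m v = ∫ x, g (m + √(v : ℝ) * x) ∂gaussianReal 0 1 := by
  rw [gaussianReal_eq_map, integral_map (by fun_prop) hg.aestronglyMeasurable]

theorem integral_sq_gaussianReal (m : ℝ) (v : ℝ≥0) :
    ∫ x, x ^ 2 ∂gaussianReal m v = m ^ 2 + v := by
  have h := variance_eq_sub ((memLp_three_gaussianReal m v).mono_exponent (p := 2) (by norm_num))
  rw [variance_id_gaussianReal] at h
  simp only [Pi.pow_apply, id, integral_id_gaussianReal] at h
  linarith

theorem exists_integral_abs_gaussianReal_le : ∃ κ : ℝ, 0 ≤ κ ∧ ∀ (m : ℝ) (v : ℝ≥0),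
    ∫ x, |x| ^ 3 ∂gaussianReal m v ≤ κ * (|m| ^ 3 + √(v : ℝ) ^ 3) ∧
    ∫ x, |x| ∂gaussianReal m v ≤ κ * (|m| + √(v : ℝ)) := by
  obtain ⟨i1, i2, i3⟩ := integrable_abs_pow_of_memLp_three (memLp_three_gaussianReal 0 1)
  have p1 : 0 ≤ ∫ x, |x| ∂gaussianReal 0 1 := integral_nonneg fun _ => abs_nonneg _
  have p3 : 0 ≤ ∫ x, |x| ^ 3 ∂gaussianReal 0 1 := integral_nonneg fun _ => by positivity
  refine ⟨4 + 4 * ∫ x, |x| ^ 3 ∂gaussianReal 0 1 + ∫ x, |x| ∂gaussianReal 0 1,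
    by positivity, fun m v => ⟨?_, ?_⟩⟩
  · rw [integral_gaussianReal_eq m v (g := fun x => |x| ^ 3) (by fun_prop)]
    have h : ∫ x, |m + √(v : ℝ) * x| ^ 3 ∂gaussianReal 0 1 ≤
        ∫ x, (4 * |m| ^ 3 + 4 * √(v : ℝ) ^ 3 * |x| ^ 3) ∂gaussianReal 0 1 := by
      refine integral_mono_of_nonneg (.of_forall fun _ => by positivity)
        ((integrable_const _).add (i3.const_mul _)) (.of_forall fun x => ?_)
      have h1 : |m + √(v : ℝ) * x| ≤ |m| + √(v : ℝ) * |x| := by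
        refine (abs_add_le _ _).trans ?_
        rw [abs_mul, abs_of_nonneg (Real.sqrt_nonneg _)]
      have h2 := add_pow_le (abs_nonneg m) (by positivity : 0 ≤ √(v : ℝ) * |x|) 3
      calc _ ≤ (|m| + √(v : ℝ) * |x|) ^ 3 := pow_le_pow_left₀ (abs_nonneg _) h1 3
        _ ≤ _ := h2
        _ = _ := by norm_num; ring
    refine h.trans ?_
    rw [integral_add (integrable_const _) (i3.const_mul _)]
    simp only [integral_const, probReal_univ, smul_eq_mul, one_mul]
    rw [integral_const_mul]
    nlinarith [mul_nonneg p3 (pow_nonneg (abs_nonneg m) 3),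
      mul_nonneg p1 (pow_nonneg (abs_nonneg m) 3), pow_nonneg (Real.sqrt_nonneg (v : ℝ)) 3,
      mul_nonneg p1 (pow_nonneg (Real.sqrt_nonneg (v : ℝ)) 3)]
  · rw [integral_gaussianReal_eq m v (g := fun x => |x|) (by fun_prop)]
    have h : ∫ x, |m + √(v : ℝ) * x| ∂gaussianReal 0 1 ≤
        ∫ x, (|m| + √(v : ℝ) * |x|) ∂gaussianReal 0 1 := by
      refine integral_mono_of_nonneg (.of_forall fun _ => abs_nonneg _)
        ((integrable_const _).add (i1.abs.const_mul _)) (.of_forall fun x => ?_)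
      refine (abs_add_le _ _).trans ?_
      rw [abs_mul, abs_of_nonneg (Real.sqrt_nonneg _)]
    refine h.trans ?_
    rw [integral_add (integrable_const _) (i1.abs.const_mul _), integral_const_mul]
    simp only [integral_const, probReal_univ, smul_eq_mul, one_mul]
    nlinarith [mul_nonneg p3 (abs_nonneg m), abs_nonneg m,
      mul_nonneg p1 (abs_nonneg m), (Real.sqrt_nonneg (v : ℝ)),
      mul_nonneg p3 ((Real.sqrt_nonneg (v : ℝ)))]

theorem gaussianReal_conv_eq (z : ℝ) (m c : ℝ≥0) :
    (gaussianReal 0 m).conv (gaussianReal z c) = gaussianReal z (m + c) := by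
  rw [gaussianReal_conv_gaussianReal, zero_add]

/-- `𝔼 f(N + z)` for a centred Gaussian `N` of variance `s'` expanded around `z = 0` and the
variance `s`. The variance enters like half a square, as the heat equation predicts. Both sides are
expanded around a Gaussian of variance `min s s'`. -/
theorem exists_gaussian_expansion : ∃ K : ℝ, 0 ≤ K ∧ ∀ f f' f'' : ℝ → ℝ, IsZolotarevTest f f' f'' →
    ∀ (s s' : ℝ≥0) (z : ℝ),
    |∫ x, f x ∂gaussianReal z s' - (∫ x, f x ∂gaussianReal 0 s + z * ∫ x, f' x ∂gaussianReal 0 s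
      + (z ^ 2 + (s' - s)) / 2 * ∫ x, f'' x ∂gaussianReal 0 s)| ≤
      K * (|z| ^ 3 + √|(s' : ℝ) - s| ^ 3) := by
  obtain ⟨κ, hκ, hm⟩ := exists_integral_abs_gaussianReal_le
  refine ⟨4 * κ + 3, by positivity, fun f f' f'' hf s s' z => ?_⟩
  obtain ⟨m, a, c, rfl, rfl, hac⟩ : ∃ m a c : ℝ≥0, s = m + a ∧ s' = m + c ∧ (a = 0 ∨ c = 0) := by
    rcases le_total s s' with h | h
    · exact ⟨s, 0, s' - s, by simp, by rw [add_tsub_cancel_of_le h], .inl rfl⟩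
    · exact ⟨s', s - s', 0, by rw [add_tsub_cancel_of_le h], by simp, .inr rfl⟩
  have hδ : ((m + c : ℝ≥0) : ℝ) - (m + a : ℝ≥0) = c - a := by push_cast; ring
  rw [hδ]
  have hL (μ : ℝ) (v : ℝ≥0) := memLp_three_gaussianReal μ v
  have hcv (μ : ℝ) (v : ℝ≥0) : MemLp id 3 ((gaussianReal 0 m).conv (gaussianReal μ v)) := by
    rw [gaussianReal_conv_eq]; exact hL _ _
  have T1 := hf.abs_integral_conv_le (hL 0 m) (hL z c) (hcv z c)
  have T2 := hf.abs_integral_conv_le (hL 0 m) (hL 0 a) (hcv 0 a)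
  have T3 := hf.abs_integral_deriv_conv_le (hL 0 m) (hL 0 a) (hcv 0 a)
  have T4 := hf.abs_integral_deriv_deriv_conv_le (hL 0 m) (hL 0 a) (hcv 0 a)
  simp only [gaussianReal_conv_eq, integral_id_gaussianReal, integral_sq_gaussianReal]
    at T1 T2 T3 T4
  replace T1 := T1.trans (hm z c).1
  replace T2 := T2.trans (hm 0 a).1
  replace T4 := T4.trans (hm 0 a).2
  set F0 := ∫ x, f x ∂gaussianReal 0 m
  set F1 := ∫ x, f' x ∂gaussianReal 0 m
  set F2 := ∫ x, f'' x ∂gaussianReal 0 m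
  set A1 := ∫ x, f x ∂gaussianReal z (m + c)
  set A2 := ∫ x, f x ∂gaussianReal 0 (m + a)
  set A3 := ∫ x, f' x ∂gaussianReal 0 (m + a)
  set A4 := ∫ x, f'' x ∂gaussianReal 0 (m + a)
  have hr : √(a : ℝ) ^ 2 = a := Real.sq_sqrt a.2
  have ht : √(c : ℝ) ^ 2 = c := Real.sq_sqrt c.2
  have hd : √|(c : ℝ) - a| ^ 3 = √(a : ℝ) ^ 3 + √(c : ℝ) ^ 3 := by
    rcases hac with h | h <;> simp [h]
  rw [hd]
  have hca : |(c : ℝ) - a| = √(a : ℝ) ^ 2 + √(c : ℝ) ^ 2 := by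
    rcases hac with h | h <;> simp [h]
  have hca0 : √(a : ℝ) * √(c : ℝ) = 0 := by
    rcases hac with h | h <;> simp [h]
  set r := √(a : ℝ)
  set t := √(c : ℝ)
  have r0 : 0 ≤ r := Real.sqrt_nonneg _
  have t0 : 0 ≤ t := Real.sqrt_nonneg _
  have z0 := abs_nonneg z
  simp only [abs_zero, ne_eq, OfNat.ofNat_ne_zero, not_false_eq_true, zero_pow, zero_add,
    zero_mul, add_zero] at T2 T3 T4
  rw [← hr] at T3
  have e : A1 - (A2 + z * A3 + (z ^ 2 + (c - a)) / 2 * A4) =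
      (A1 - (F0 + z * F1 + (z ^ 2 + c) / 2 * F2)) - (A2 - (F0 + a / 2 * F2)) - z * (A3 - F1)
        - (z ^ 2 + (c - a)) / 2 * (A4 - F2) := by ring
  rw [e]
  have B3 : |z * (A3 - F1)| ≤ |z| ^ 3 + r ^ 3 := by
    rw [abs_mul]
    refine (mul_le_mul_of_nonneg_left T3 z0).trans ?_
    nlinarith [mul_nonneg z0 r0, mul_nonneg (add_nonneg z0 r0) (sq_nonneg (|z| - r)),
      pow_nonneg z0 3, pow_nonneg r0 3]
  have B4 : |(z ^ 2 + (c - a)) / 2 * (A4 - F2)| ≤ κ * (|z| ^ 3 + r ^ 3 * 2) := by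
    have h1 : |(z ^ 2 + ((c : ℝ) - a)) / 2| ≤ (|z| ^ 2 + (r ^ 2 + t ^ 2)) / 2 := by
      rw [abs_div, ← hca, abs_two]
      gcongr
      exact (abs_add_le _ _).trans (by simp)
    rw [abs_mul]
    refine (mul_le_mul h1 T4 (abs_nonneg _) (by positivity)).trans ?_
    have h2 : (|z| ^ 2 + (r ^ 2 + t ^ 2)) / 2 * (κ * r) =
        κ * ((|z| ^ 2 * r + r ^ 3 + t * (r * t)) / 2) := by ring
    rw [h2, hca0]
    gcongr
    nlinarith [mul_nonneg z0 r0, mul_nonneg (add_nonneg z0 r0) (sq_nonneg (|z| - r)),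
      pow_nonneg z0 3, pow_nonneg r0 3]
  refine (abs_sub _ _).trans ((add_le_add ((abs_sub _ _).trans (add_le_add ((abs_sub _ _).trans
    (add_le_add T1 T2)) B3)) B4).trans ?_)
  have := pow_nonneg z0 3
  have := pow_nonneg r0 3
  have := pow_nonneg t0 3
  nlinarith [mul_nonneg hκ (pow_nonneg z0 3), mul_nonneg hκ (pow_nonneg r0 3),
    mul_nonneg hκ (pow_nonneg t0 3)]

/-! ### Recursions driven by a uniform average -/

/-- The harmonic number `1 + 1/2 + ⋯ + 1/n` as a real number. -/
noncomputable def harm (n : ℕ) : ℝ := (harmonic n : ℝ)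

/-- `1 + (1 + 1/2 + ⋯ + 1/n)`, the scale `ln n` of the problem, bounded below by `1`. -/
noncomputable def lg (n : ℕ) : ℝ := 1 + harm n

theorem harm_zero : harm 0 = 0 := by simp [harm]

theorem harm_succ (n : ℕ) : harm (n + 1) = harm n + 1 / ((n : ℝ) + 1) := by
  simp [harm, harmonic_succ]

theorem harm_mono : Monotone harm := by
  refine monotone_nat_of_le_succ fun n => ?_
  rw [harm_succ]
  have : 0 ≤ 1 / ((n : ℝ) + 1) := by positivity
  linarith

theorem harm_nonneg (n : ℕ) : 0 ≤ harm n := by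
  simpa [harm_zero] using harm_mono (Nat.zero_le n)

theorem lg_mono : Monotone lg := fun _ _ h => by simpa [lg] using harm_mono h

theorem one_le_lg (n : ℕ) : 1 ≤ lg n := by simpa [lg] using harm_nonneg n

theorem lg_succ (n : ℕ) : lg (n + 1) = lg n + 1 / ((n : ℝ) + 1) := by
  simp [lg, harm_succ, add_assoc]

theorem log_le_lg (n : ℕ) : Real.log n ≤ lg n := by
  rcases Nat.eq_zero_or_pos n with rfl | hn
  · simpa using (one_le_lg 0).trans' zero_le_one
  have h1 := log_add_one_le_harmonic n
  have h2 : Real.log n ≤ Real.log ((n + 1 : ℕ) : ℝ) :=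
    Real.log_le_log (by exact_mod_cast hn) (by push_cast; linarith)
  unfold lg harm
  linarith

theorem tendsto_lg : Tendsto lg atTop atTop :=
  tendsto_atTop_mono log_le_lg (Real.tendsto_log_atTop.comp tendsto_natCast_atTop_atTop)

theorem natLog_le_two_mul_lg (n : ℕ) : (Nat.log 2 n : ℝ) ≤ 2 * lg n := by
  rcases Nat.eq_zero_or_pos n with rfl | hn
  · have := one_le_lg 0
    simp only [Nat.log_zero_right, Nat.cast_zero]
    linarith
  have h1 : ((2 : ℝ) ^ Nat.log 2 n) ≤ n := by exact_mod_cast Nat.pow_log_le_self 2 hn.ne'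
  have h2 := Real.log_le_log (by positivity) h1
  rw [Real.log_pow] at h2
  have h3 := log_le_lg n
  have h4 := Real.log_two_gt_d9
  have h5 : (0 : ℝ) ≤ Nat.log 2 n := by positivity
  nlinarith

theorem lg_le_natLog_add {n : ℕ} (hn : 1 ≤ n) : lg n ≤ Nat.log 2 n + 3 := by
  have h1 : (n : ℝ) ≤ 2 ^ (Nat.log 2 n + 1) := by
    exact_mod_cast (Nat.lt_pow_succ_log_self (by norm_num) n).le
  have h2 := Real.log_le_log (by exact_mod_cast hn) h1
  rw [Real.log_pow] at h2
  have h3 := harmonic_le_one_add_log n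
  have h4 := Real.log_two_lt_d9
  have h5 : (0 : ℝ) ≤ Nat.log 2 n := by positivity
  unfold lg harm
  push_cast at h2
  nlinarith

theorem harm_sub_harm_le {i n : ℕ} (hin : i ≤ n) (hi : 0 < i) :
    harm n - harm i ≤ ((n : ℝ) - i) / i := by
  induction n, hin using Nat.le_induction with
  | base => simp
  | succ k hk ih =>
    have hi' : (0 : ℝ) < i := by exact_mod_cast hi
    have hk' : (i : ℝ) ≤ k := by exact_mod_cast hk
    have : 1 / ((k : ℝ) + 1) ≤ 1 / i := by gcongr; linarith
    rw [harm_succ]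
    calc _ ≤ ((k : ℝ) - i) / i + 1 / i := by linarith
      _ = _ := by push_cast; ring

/-- The amount by which `x n` exceeds the average of its predecessors. Division by zero makes
`toll x 0 = x 0`, but `sub_toll_succ` at `n = 0` would hold for any value there. -/
noncomputable def toll (x : ℕ → ℝ) (n : ℕ) : ℝ := x n - (∑ j ∈ Finset.range n, x j) / n

/-- `n * (x n - toll x n)` is the sum of the predecessors, so that raising `n` by one adds `x n`
to it. -/
theorem sub_toll_succ (x : ℕ → ℝ) (n : ℕ) :
    x (n + 1) - toll x (n + 1) = x n - toll x n + toll x n / ((n : ℝ) + 1) := by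
  have h1 : x (n + 1) - toll x (n + 1) = (∑ j ∈ Finset.range n, x j + x n) / ((n : ℝ) + 1) := by
    rw [toll, Finset.sum_range_succ]; push_cast; ring
  rw [h1]
  rcases Nat.eq_zero_or_pos n with rfl | hn
  · simp [toll]
  have : (n : ℝ) ≠ 0 := by exact_mod_cast hn.ne'
  have : (n : ℝ) + 1 ≠ 0 := by positivity
  unfold toll
  field_simp
  ring

theorem sub_toll_sub_le {x : ℕ → ℝ} {T : ℝ} {i n : ℕ} (hin : i ≤ n)
    (hT : ∀ k, i ≤ k → k < n → toll x k ≤ T) :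
    (x n - toll x n) - (x i - toll x i) ≤ T * (harm n - harm i) := by
  induction n, hin using Nat.le_induction with
  | base => simp
  | succ k hk ih =>
    have h1 := ih fun j h1 h2 => hT j h1 (by omega)
    have h2 := hT k hk (by omega)
    rw [sub_toll_succ, harm_succ]
    have : toll x k / ((k : ℝ) + 1) ≤ T / ((k : ℝ) + 1) := by gcongr
    calc _ ≤ T * (harm k - harm i) + T / ((k : ℝ) + 1) := by linarith
      _ = _ := by ring

theorem toll_neg (x : ℕ → ℝ) (n : ℕ) : toll (fun k => -x k) n = -toll x n := by
  simp [toll, neg_div]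
  ring

theorem abs_sub_le_of_toll_le {x : ℕ → ℝ} {T : ℝ} {i n : ℕ} (hin : i ≤ n)
    (hT : ∀ k ≤ n, |toll x k| ≤ T) : |x n - x i| ≤ T * (2 + (harm n - harm i)) := by
  have h1 := sub_toll_sub_le (x := x) (T := T) hin fun k _ h => (abs_le.1 (hT k h.le)).2
  have h2 := sub_toll_sub_le (x := fun k => -x k) (T := T) hin fun k _ h => by
    rw [toll_neg]; linarith [(abs_le.1 (hT k h.le)).1]
  simp only [toll_neg] at h2
  have h3 := abs_le.1 (hT n le_rfl)
  have h4 := abs_le.1 (hT i hin)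
  rw [abs_le]
  constructor <;> linarith

theorem sum_harm_sub (n : ℕ) : ∑ i ∈ Finset.range n, (harm n - harm i) = n := by
  induction n with
  | zero => simp
  | succ n ih =>
    have h : ∀ i ∈ Finset.range n, harm (n + 1) - harm i = (harm n - harm i) + 1 / ((n : ℝ) + 1) :=
      fun i _ => by rw [harm_succ]; ring
    rw [Finset.sum_range_succ, Finset.sum_congr rfl h, Finset.sum_add_distrib, ih, harm_succ]
    simp only [Finset.sum_const, Finset.card_range, nsmul_eq_mul]
    push_cast
    field_simp
    ring

theorem sum_harm_sub_sq_le (n : ℕ) : ∑ i ∈ Finset.range n, (harm n - harm i) ^ 2 ≤ 2 * n := by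
  induction n with
  | zero => simp
  | succ n ih =>
    have h : ∀ i ∈ Finset.range n, (harm (n + 1) - harm i) ^ 2 = (harm n - harm i) ^ 2
        + 2 / ((n : ℝ) + 1) * (harm n - harm i) + 1 / ((n : ℝ) + 1) ^ 2 :=
      fun i _ => by rw [harm_succ]; field_simp; ring
    rw [Finset.sum_range_succ, Finset.sum_congr rfl h, Finset.sum_add_distrib,
      Finset.sum_add_distrib, ← Finset.mul_sum, sum_harm_sub, harm_succ]
    simp only [Finset.sum_const, Finset.card_range, nsmul_eq_mul]
    have : 2 / ((n : ℝ) + 1) * n + n * (1 / ((n : ℝ) + 1) ^ 2) + (1 / ((n : ℝ) + 1)) ^ 2 ≤ 2 := by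
      rw [show 2 / ((n : ℝ) + 1) * n + n * (1 / ((n : ℝ) + 1) ^ 2) + (1 / ((n : ℝ) + 1)) ^ 2 =
        (2 * n + 1) / (n + 1) by field_simp; ring, div_le_iff₀ (by positivity)]
      linarith
    push_cast
    rw [show harm n + 1 / ((n : ℝ) + 1) - harm n = 1 / ((n : ℝ) + 1) by ring]
    linarith

theorem sum_harm_sub_cube_le (n : ℕ) : ∑ i ∈ Finset.range n, (harm n - harm i) ^ 3 ≤ 6 * n := by
  induction n with
  | zero => simp
  | succ n ih =>
    have h : ∀ i ∈ Finset.range n, (harm (n + 1) - harm i) ^ 3 = (harm n - harm i) ^ 3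
        + 3 / ((n : ℝ) + 1) * (harm n - harm i) ^ 2 + 3 / ((n : ℝ) + 1) ^ 2 * (harm n - harm i)
        + 1 / ((n : ℝ) + 1) ^ 3 :=
      fun i _ => by rw [harm_succ]; field_simp; ring
    rw [Finset.sum_range_succ, Finset.sum_congr rfl h, Finset.sum_add_distrib,
      Finset.sum_add_distrib, Finset.sum_add_distrib, ← Finset.mul_sum, ← Finset.mul_sum,
      sum_harm_sub, harm_succ]
    simp only [Finset.sum_const, Finset.card_range, nsmul_eq_mul]
    have h2 := sum_harm_sub_sq_le n
    have h3 : 3 / ((n : ℝ) + 1) * ∑ i ∈ Finset.range n, (harm n - harm i) ^ 2 ≤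
      3 / ((n : ℝ) + 1) * (2 * n) := by gcongr
    have : 3 / ((n : ℝ) + 1) * (2 * n) + 3 / ((n : ℝ) + 1) ^ 2 * n + n * (1 / ((n : ℝ) + 1) ^ 3)
        + (1 / ((n : ℝ) + 1)) ^ 3 ≤ 6 := by
      rw [show 3 / ((n : ℝ) + 1) * (2 * n) + 3 / ((n : ℝ) + 1) ^ 2 * n
          + n * (1 / ((n : ℝ) + 1) ^ 3) + (1 / ((n : ℝ) + 1)) ^ 3 =
        (6 * n * (n + 1) + 3 * n + 1) / (n + 1) ^ 2 by field_simp; ring,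
        div_le_iff₀ (by positivity)]
      nlinarith [(Nat.cast_nonneg n : (0 : ℝ) ≤ n)]
    push_cast
    rw [show harm n + 1 / ((n : ℝ) + 1) - harm n = 1 / ((n : ℝ) + 1) by ring]
    linarith

theorem average_two_add_harm_sub_cube_le {n : ℕ} (hn : 1 ≤ n) :
    (∑ i ∈ Finset.range n, (2 + (harm n - harm i)) ^ 3) / (n : ℝ) ≤ 56 := by
  have hn' : (0 : ℝ) < n := by exact_mod_cast hn
  rw [div_le_iff₀ hn']
  calc ∑ i ∈ Finset.range n, (2 + (harm n - harm i)) ^ 3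
      ≤ ∑ i ∈ Finset.range n, (32 + 4 * (harm n - harm i) ^ 3) := by
        refine Finset.sum_le_sum fun i hi => ?_
        have h : 0 ≤ harm n - harm i := sub_nonneg.2 (harm_mono (Finset.mem_range.1 hi).le)
        have := add_pow_le (zero_le_two (α := ℝ)) h 3
        norm_num at this
        linarith
    _ = 32 * n + 4 * ∑ i ∈ Finset.range n, (harm n - harm i) ^ 3 := by
        rw [Finset.sum_add_distrib, ← Finset.mul_sum]; simp [mul_comm]
    _ ≤ 56 * n := by linarith [sum_harm_sub_cube_le n]

/-- Averaging `lg ^ 4` over the predecessors loses a term of order `lg ^ 3`. -/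
theorem average_lg_pow_four_le {n : ℕ} (hn : 1 ≤ n) :
    (∑ i ∈ Finset.range n, lg i ^ 4) / n ≤ lg n ^ 4 - lg n ^ 3 := by
  have hn' : (0 : ℝ) < n := by exact_mod_cast hn
  rw [div_le_iff₀ hn']
  calc ∑ i ∈ Finset.range n, lg i ^ 4
      ≤ ∑ i ∈ Finset.range n, (lg n ^ 4 - lg n ^ 3 * (harm n - harm i)) := by
        refine Finset.sum_le_sum fun i hi => ?_
        have h := lg_mono (Finset.mem_range.1 hi).le
        have h0 := one_le_lg i
        have h1 : harm n - harm i = lg n - lg i := by simp [lg]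
        have h2 : lg i ^ 3 ≤ lg n ^ 3 := by gcongr
        rw [h1]
        nlinarith
    _ = _ := by
        rw [Finset.sum_sub_distrib, ← Finset.mul_sum, sum_harm_sub]
        simp
        ring

theorem lg_succ_pow_three_sub_le (n : ℕ) :
    lg (n + 1) ^ 3 - lg n ^ 3 ≤ 12 * (lg n ^ 2 / ((n : ℝ) + 1)) := by
  have h1 : 1 / ((n : ℝ) + 1) ≤ 1 := by
    rw [div_le_one (by positivity)]; linarith [(Nat.cast_nonneg n : (0 : ℝ) ≤ n)]
  have h0 : 0 ≤ 1 / ((n : ℝ) + 1) := by positivity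
  have h2 := one_le_lg n
  rw [lg_succ, div_eq_mul_one_div (lg n ^ 2)]
  set a := 1 / ((n : ℝ) + 1)
  have e : (lg n + a) ^ 3 - lg n ^ 3 = a * (3 * lg n ^ 2 + 3 * lg n * a + a ^ 2) := by ring
  rw [e, mul_comm (lg n ^ 2), mul_left_comm]
  gcongr
  nlinarith

/-- A sequence whose toll is of order `lg ^ 2` grows at least like `lg ^ 3`. -/
theorem exists_lg_pow_three_le_of_toll {x : ℕ → ℝ} {c : ℝ} (hc : 0 < c)
    (h : ∀ᶠ n in atTop, c * lg n ^ 2 ≤ toll x n) :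
    ∃ c', 0 < c' ∧ ∀ᶠ n in atTop, c' * lg n ^ 3 ≤ x n := by
  obtain ⟨N, hN⟩ := eventually_atTop.1 h
  refine ⟨c / 24, by positivity, ?_⟩
  have key : ∀ n, N ≤ n → x N - toll x N - c / 12 * lg N ^ 3 ≤
      x n - toll x n - c / 12 * lg n ^ 3 := by
    intro n hn
    induction n, hn using Nat.le_induction with
    | base => exact le_rfl
    | succ k hk ih =>
      have h1 := lg_succ_pow_three_sub_le k
      have h2 : c * lg k ^ 2 / ((k : ℝ) + 1) ≤ toll x k / ((k : ℝ) + 1) := by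
        have := hN k hk
        gcongr
      rw [sub_toll_succ]
      have h3 : c / 12 * (lg (k + 1) ^ 3 - lg k ^ 3) ≤
        c / 12 * (12 * (lg k ^ 2 / ((k : ℝ) + 1))) := by gcongr
      have h4 : c / 12 * (12 * (lg k ^ 2 / ((k : ℝ) + 1))) = c * lg k ^ 2 / ((k : ℝ) + 1) := by ring
      linarith
  have ht := tendsto_lg.eventually_ge_atTop
    (max 1 (24 / c * |x N - toll x N - c / 12 * lg N ^ 3|))
  filter_upwards [ht, eventually_ge_atTop N] with n h1 h2
  have h3 := key n h2
  have h4 := hN n h2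
  have h5 := neg_abs_le (x N - toll x N - c / 12 * lg N ^ 3)
  set E := |x N - toll x N - c / 12 * lg N ^ 3|
  have h6 : 24 / c * E ≤ lg n := (le_max_right _ _).trans h1
  have h7 : lg n ≤ lg n ^ 3 := le_self_pow₀ (one_le_lg n) (by norm_num)
  have h8 : E ≤ c / 24 * lg n ^ 3 := by
    have : E = c / 24 * (24 / c * E) := by field_simp
    rw [this]
    gcongr
    exact h6.trans h7
  have h9 : 0 ≤ c * lg n ^ 2 := by positivity
  linarith

/-! ### The distributional recursion and its moments -/

/-- The recursion `Y n = Y (I n) + b n` in law, with uniform index `I n` and leader election toll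
`b n`. The joint law of `I n` and `b n` is arbitrary. -/
structure IsElectionRecursion {Ω : Type*} [MeasurableSpace Ω] (P : Measure Ω)
    (Y I b : ℕ → Ω → ℕ) : Prop where
  measurable_Y : ∀ n, Measurable (Y n)
  measurable_I : ∀ n, Measurable (I n)
  measurable_b : ∀ n, Measurable (b n)
  ae_Y_zero : ∀ᵐ ω ∂P, Y 0 ω = 1
  ae_Y_one : ∀ᵐ ω ∂P, Y 1 ω = 1
  map_I : ∀ n, 2 ≤ n → P.map (I n) = uniformOn (Set.Iio n)
  map_b : ∀ n, 2 ≤ n → P.map (b n) = electionLaw n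
  indepFun : ∀ n, 2 ≤ n → IndepFun (fun ω => (I n ω, b n ω)) (fun ω k => Y k ω) P
  map_Y : ∀ n, 2 ≤ n → P.map (Y n) = P.map (fun ω => Y (I n ω) ω + b n ω)

/-- The expectation of `Y n`. -/
noncomputable def meanY {Ω : Type*} [MeasurableSpace Ω] (P : Measure Ω) (Y : ℕ → Ω → ℕ) (n : ℕ) :
    ℝ := ∫ ω, (Y n ω : ℝ) ∂P

/-- The variance of `Y n`. -/
noncomputable def varY {Ω : Type*} [MeasurableSpace Ω] (P : Measure Ω) (Y : ℕ → Ω → ℕ) (n : ℕ) :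
    ℝ := ∫ ω, ((Y n ω : ℝ) - meanY P Y n) ^ 2 ∂P

/-- The toll of the centred recursion: `Y n - 𝔼 Y n` has the law of
`Y (I n) - 𝔼 Y (I n) + centredToll n`. -/
noncomputable def centredToll {Ω : Type*} [MeasurableSpace Ω] (P : Measure Ω)
    (Y I b : ℕ → Ω → ℕ) (n : ℕ) (ω : Ω) : ℝ :=
  (b n ω : ℝ) - meanY P Y n + meanY P Y (I n ω)

theorem varY_nonneg {Ω : Type*} [MeasurableSpace Ω] (P : Measure Ω) (Y : ℕ → Ω → ℕ) (n : ℕ) :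
    0 ≤ varY P Y n := integral_nonneg fun _ => sq_nonneg _

namespace IsElectionRecursion

variable {Ω : Type*} [MeasurableSpace Ω] {P : Measure Ω}
  {Y I b : ℕ → Ω → ℕ}

theorem integral_index (R : IsElectionRecursion P Y I b) {n : ℕ} (hn : 2 ≤ n) (G : ℕ → ℝ) :
    ∫ ω, G (I n ω) ∂P = (∑ j ∈ Finset.range n, G j) / n := by
  have h1 : ∫ ω, G (I n ω) ∂P = ∫ k, G k ∂(P.map (I n)) := by
    rw [integral_map (R.measurable_I n).aemeasurable
      (measurable_of_countable _).aestronglyMeasurable]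
  have h2 : Set.Iio n = ((Finset.range n : Finset ℕ) : Set ℕ) := by ext; simp
  rw [h1, R.map_I n hn, uniformOn, ProbabilityTheory.cond, integral_smul_measure, h2,
    setIntegral_finset, Measure.count_apply_finset]
  · simp [div_eq_inv_mul, measureReal_def]
  · rw [← (Finset.range n : Set ℕ).biUnion_of_singleton]
    refine (integrableOn_finset_iUnion (s := Finset.range n) (t := fun x => {x})).2 fun i _ => ?_
    exact integrableOn_singleton (hx := by simp)

theorem ae_index_lt (R : IsElectionRecursion P Y I b) {n : ℕ} (hn : 2 ≤ n) :
    ∀ᵐ ω ∂P, I n ω < n := by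
  have h : ∀ᵐ k ∂(P.map (I n)), k ∈ Set.Iio n := by
    rw [R.map_I n hn]
    exact ae_cond_mem (Set.to_countable _).measurableSet
  exact ae_of_ae_map (R.measurable_I n).aemeasurable h

theorem add_sub_meanY_eq (n : ℕ) (ω ω' : Ω) :
    ((Y (I n ω') ω + b n ω' : ℕ) : ℝ) - meanY P Y n =
      ((Y (I n ω') ω : ℝ) - meanY P Y (I n ω')) + centredToll P Y I b n ω' := by
  simp only [centredToll]
  push_cast
  ring

variable [IsProbabilityMeasure P]

theorem memLp_index (R : IsElectionRecursion P Y I b) {n : ℕ} (hn : 2 ≤ n) (G : ℕ → ℝ)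
    (p : ℝ≥0∞) : MemLp (fun ω => G (I n ω)) p P := by
  refine MemLp.of_bound ((measurable_of_countable G).comp (R.measurable_I n)).aestronglyMeasurable
    (∑ j ∈ Finset.range n, ‖G j‖) ?_
  filter_upwards [R.ae_index_lt hn] with ω h
  exact Finset.single_le_sum (f := fun j => ‖G j‖) (fun _ _ => norm_nonneg _)
    (Finset.mem_range.2 h)

theorem integrable_index (R : IsElectionRecursion P Y I b) {n : ℕ} (hn : 2 ≤ n) (G : ℕ → ℝ) :
    Integrable (fun ω => G (I n ω)) P :=
  (R.memLp_index hn G 1).integrable le_rfl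

/-- The third absolute moment of `b n - log₂ n` is bounded. -/
theorem exists_moment_b (R : IsElectionRecursion P Y I b) : ∃ C : ℝ, 0 ≤ C ∧ ∀ n, 2 ≤ n →
    MemLp (fun ω => (b n ω : ℝ)) 3 P ∧ ∫ ω, |(b n ω : ℝ) - Nat.log 2 n| ^ 3 ∂P ≤ C := by
  obtain ⟨C, hC, h⟩ := exists_electionLaw_moment_le
  refine ⟨C, hC, fun n hn => ?_⟩
  have h1 : ∫⁻ ω, ENNReal.ofReal (|(b n ω : ℝ) - Nat.log 2 n| ^ 3) ∂P ≤ ENNReal.ofReal C := by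
    rw [← lintegral_map (f := fun k : ℕ => ENNReal.ofReal (|(k : ℝ) - Nat.log 2 n| ^ 3))
      (measurable_of_countable _) (R.measurable_b n), R.map_b n hn]
    exact h n (by omega)
  have hm : Measurable fun ω => (b n ω : ℝ) :=
    (measurable_of_countable (fun k : ℕ => (k : ℝ))).comp (R.measurable_b n)
  have h2 : MemLp (fun ω => (b n ω : ℝ) - Nat.log 2 n) 3 P := by
    refine ⟨(hm.sub_const _).aestronglyMeasurable, ?_⟩
    rw [eLpNorm_lt_top_iff_lintegral_rpow_enorm_lt_top (by norm_num) (by norm_num)]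
    refine lt_of_le_of_lt (le_of_eq ?_) (h1.trans_lt ENNReal.ofReal_lt_top)
    refine lintegral_congr fun ω => ?_
    rw [Real.enorm_eq_ofReal_abs, ENNReal.ofReal_pow (abs_nonneg _)]
    norm_num
  refine ⟨?_, ?_⟩
  · have := h2.add (memLp_const (Nat.log 2 n : ℝ))
    refine (memLp_congr_ae (.of_forall fun ω => ?_)).1 this
    simp
  · rw [integral_eq_lintegral_of_nonneg_ae (.of_forall fun _ => by positivity)
      ((hm.sub_const _).abs.pow_const 3).aestronglyMeasurable]
    exact ENNReal.toReal_le_of_le_ofReal hC h1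

theorem memLp_Y (R : IsElectionRecursion P Y I b) (n : ℕ) :
    MemLp (fun ω => (Y n ω : ℝ)) 3 P := by
  induction n using Nat.strong_induction_on with
  | _ n ih =>
    rcases Nat.lt_or_ge n 2 with hn | hn
    · have : ∀ᵐ ω ∂P, (Y n ω : ℝ) = 1 := by
        interval_cases n
        · filter_upwards [R.ae_Y_zero] with ω h; simp [h]
        · filter_upwards [R.ae_Y_one] with ω h; simp [h]
      exact (memLp_congr_ae this).2 (memLp_const 1)
    obtain ⟨C, -, hb⟩ := R.exists_moment_b
    have hmeas : Measurable fun ω => Y (I n ω) ω :=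
      measurable_from_prod_countable_right (f := fun q : ℕ × Ω => Y q.1 q.2) R.measurable_Y |>.comp
        ((R.measurable_I n).prodMk measurable_id)
    have hid : IdentDistrib (Y n) (fun ω => Y (I n ω) ω + b n ω) P P :=
      ⟨(R.measurable_Y n).aemeasurable, (hmeas.add (R.measurable_b n)).aemeasurable, R.map_Y n hn⟩
    have hid2 := hid.comp (u := fun k : ℕ => (k : ℝ)) (measurable_of_countable _)
    refine (hid2.memLp_iff (p := 3)).2 ?_
    have hs : MemLp (fun ω => ∑ j ∈ Finset.range n, (Y j ω : ℝ)) 3 P :=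
      memLp_finsetSum _ fun j hj => ih j (Finset.mem_range.1 hj)
    refine (hs.add (hb n hn).1).mono
      ((measurable_of_countable (fun k : ℕ => (k : ℝ))).comp
        (hmeas.add (R.measurable_b n))).aestronglyMeasurable ?_
    filter_upwards [R.ae_index_lt hn] with ω h
    have h1 : (Y (I n ω) ω : ℝ) ≤ ∑ j ∈ Finset.range n, (Y j ω : ℝ) :=
      Finset.single_le_sum (f := fun j => (Y j ω : ℝ)) (fun _ _ => by positivity)
        (Finset.mem_range.2 h)
    simp only [Function.comp, Pi.add_apply, Real.norm_eq_abs, Nat.cast_add]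
    rw [abs_of_nonneg (by positivity), abs_of_nonneg (by positivity)]
    linarith

/-- Conditioning the recursion on the pair `(I n, b n)`. -/
theorem integral_rec (R : IsElectionRecursion P Y I b) {n : ℕ} (hn : 2 ≤ n) {g : ℕ → ℝ}
    (hg : Integrable (fun ω => g (Y n ω)) P) :
    Integrable (fun ω' => ∫ ω, g (Y (I n ω') ω + b n ω') ∂P) P ∧
    ∫ ω, g (Y n ω) ∂P = ∫ ω', (∫ ω, g (Y (I n ω') ω + b n ω') ∂P) ∂P := by
  have hm1 : Measurable fun ω => (I n ω, b n ω) := (R.measurable_I n).prodMk (R.measurable_b n)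
  have hm2 : Measurable fun (ω : Ω) (k : ℕ) => Y k ω := measurable_pi_lambda _ R.measurable_Y
  have hgm : Measurable g := measurable_of_countable g
  set Φ : (ℕ × ℕ) × (ℕ → ℕ) → ℕ := fun q => q.2 q.1.1 + q.1.2 with hΦ
  have hΦm : Measurable Φ :=
    measurable_from_prod_countable_right fun q =>
      (measurable_of_countable (· + q.2)).comp (measurable_pi_apply q.1)
  have hmap : (P.map (Y n)) = ((P.map fun ω => (I n ω, b n ω)).prod
      (P.map fun ω k => Y k ω)).map Φ := by
    rw [R.map_Y n hn, ← (indepFun_iff_map_prod_eq_prod_map_map hm1.aemeasurable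
      hm2.aemeasurable).1 (R.indepFun n hn), Measure.map_map hΦm (hm1.prodMk hm2)]
    rfl
  have hi : Integrable g (P.map (Y n)) :=
    (integrable_map_measure hgm.aestronglyMeasurable (R.measurable_Y n).aemeasurable).2 hg
  have := Measure.isProbabilityMeasure_map (μ := P) hm1.aemeasurable
  have := Measure.isProbabilityMeasure_map (μ := P) hm2.aemeasurable
  have hi2 : Integrable (fun q => g (Φ q)) ((P.map fun ω => (I n ω, b n ω)).prod
      (P.map fun ω k => Y k ω)) := by
    rw [hmap] at hi
    exact (integrable_map_measure hgm.aestronglyMeasurable hΦm.aemeasurable).1 hi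
  have hinner (q : ℕ × ℕ) : ∫ y, g (Φ (q, y)) ∂(P.map fun ω k => Y k ω) =
      ∫ ω, g (Y q.1 ω + q.2) ∂P := by
    rw [integral_map hm2.aemeasurable]
    exact (hgm.comp (hΦm.comp measurable_prodMk_left)).aestronglyMeasurable
  constructor
  · have h1 := hi2.integral_prod_left
    simp only [hinner] at h1
    exact (integrable_map_measure (f := fun ω => (I n ω, b n ω))
      (g := fun q : ℕ × ℕ => ∫ ω, g (Y q.1 ω + q.2) ∂P)
      (measurable_of_countable _).aestronglyMeasurable hm1.aemeasurable).1 h1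
  · calc ∫ ω, g (Y n ω) ∂P = ∫ k, g k ∂(P.map (Y n)) := by
          rw [integral_map (R.measurable_Y n).aemeasurable hgm.aestronglyMeasurable]
      _ = ∫ q, g (Φ q) ∂((P.map fun ω => (I n ω, b n ω)).prod (P.map fun ω k => Y k ω)) := by
          rw [hmap, integral_map hΦm.aemeasurable hgm.aestronglyMeasurable]
      _ = ∫ q : ℕ × ℕ, (∫ ω, g (Y q.1 ω + q.2) ∂P) ∂(P.map fun ω => (I n ω, b n ω)) := by
          rw [integral_prod _ hi2]
          simp only [hinner]
      _ = _ := by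
          rw [integral_map hm1.aemeasurable (measurable_of_countable _).aestronglyMeasurable]

theorem integrable_Y (R : IsElectionRecursion P Y I b) (n : ℕ) :
    Integrable (fun ω => (Y n ω : ℝ)) P := (R.memLp_Y n).integrable (by norm_num)

theorem integrable_b (R : IsElectionRecursion P Y I b) {n : ℕ} (hn : 2 ≤ n) :
    Integrable (fun ω => (b n ω : ℝ)) P := by
  obtain ⟨C, -, hb⟩ := R.exists_moment_b
  exact (hb n hn).1.integrable (by norm_num)

theorem meanY_zero (R : IsElectionRecursion P Y I b) : meanY P Y 0 = 1 := by
  rw [meanY, integral_congr_ae (g := fun _ => (1 : ℝ))]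
  · simp
  · filter_upwards [R.ae_Y_zero] with ω h; simp [h]

theorem meanY_one (R : IsElectionRecursion P Y I b) : meanY P Y 1 = 1 := by
  rw [meanY, integral_congr_ae (g := fun _ => (1 : ℝ))]
  · simp
  · filter_upwards [R.ae_Y_one] with ω h; simp [h]

theorem ae_centred_eq_zero (R : IsElectionRecursion P Y I b) {n : ℕ} (hn : n < 2) :
    ∀ᵐ ω ∂P, (Y n ω : ℝ) - meanY P Y n = 0 := by
  interval_cases n
  · filter_upwards [R.ae_Y_zero] with ω h; simp [h, R.meanY_zero]
  · filter_upwards [R.ae_Y_one] with ω h; simp [h, R.meanY_one]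

theorem varY_eq_zero (R : IsElectionRecursion P Y I b) {n : ℕ} (hn : n < 2) :
    varY P Y n = 0 := by
  rw [varY, integral_congr_ae (g := fun _ => (0 : ℝ))]
  · simp
  · filter_upwards [R.ae_centred_eq_zero hn] with ω h; simp [h]

theorem toll_meanY (R : IsElectionRecursion P Y I b) {n : ℕ} (hn : 2 ≤ n) :
    toll (meanY P Y) n = ∫ ω, (b n ω : ℝ) ∂P := by
  have h := (R.integral_rec hn (g := fun k => (k : ℝ)) (R.integrable_Y n)).2
  have h2 : ∀ ω', ∫ ω, ((Y (I n ω') ω + b n ω' : ℕ) : ℝ) ∂P = meanY P Y (I n ω') + b n ω' := by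
    intro ω'
    simp only [Nat.cast_add]
    rw [integral_add (R.integrable_Y _) (integrable_const _)]
    simp [meanY]
  simp only [h2] at h
  rw [integral_add (R.integrable_index hn _) (R.integrable_b hn), R.integral_index hn] at h
  change meanY P Y n = _ at h
  rw [toll, h]
  ring

theorem memLp_centredToll (R : IsElectionRecursion P Y I b) {n : ℕ} (hn : 2 ≤ n) :
    MemLp (centredToll P Y I b n) 3 P := by
  obtain ⟨C, -, hb⟩ := R.exists_moment_b
  exact ((hb n hn).1.sub (memLp_const _)).add (R.memLp_index hn _ 3)

theorem integral_centredToll (R : IsElectionRecursion P Y I b) {n : ℕ} (hn : 2 ≤ n) :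
    ∫ ω, centredToll P Y I b n ω ∂P = 0 := by
  have h1 : Integrable (fun ω => (b n ω : ℝ) - meanY P Y n) P :=
    (R.integrable_b hn).sub (integrable_const _)
  unfold centredToll
  rw [integral_add h1 (R.integrable_index hn _), integral_sub (R.integrable_b hn)
    (integrable_const _), R.integral_index hn, ← R.toll_meanY hn, toll]
  simp

theorem integral_centred (R : IsElectionRecursion P Y I b) (n : ℕ) :
    ∫ ω, ((Y n ω : ℝ) - meanY P Y n) ∂P = 0 := by
  rw [integral_sub (R.integrable_Y n) (integrable_const _)]
  simp [meanY]

theorem memLp_centred (R : IsElectionRecursion P Y I b) (n : ℕ) :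
    MemLp (fun ω => (Y n ω : ℝ) - meanY P Y n) 3 P := (R.memLp_Y n).sub (memLp_const _)

theorem toll_varY (R : IsElectionRecursion P Y I b) {n : ℕ} (hn : 2 ≤ n) :
    toll (varY P Y) n = ∫ ω, centredToll P Y I b n ω ^ 2 ∂P := by
  have hsq (n : ℕ) : Integrable (fun ω => ((Y n ω : ℝ) - meanY P Y n) ^ 2) P :=
    ((R.memLp_centred n).mono_exponent (p := 2) (by norm_num)).integrable_sq
  have h := (R.integral_rec hn (g := fun k => ((k : ℝ) - meanY P Y n) ^ 2) (hsq n)).2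
  have h2 : ∀ ω', ∫ ω, (((Y (I n ω') ω + b n ω' : ℕ) : ℝ) - meanY P Y n) ^ 2 ∂P =
      varY P Y (I n ω') + centredToll P Y I b n ω' ^ 2 := by
    intro ω'
    simp only [add_sub_meanY_eq]
    set z := centredToll P Y I b n ω'
    set i := I n ω'
    have h3 : ∀ ω, ((Y i ω : ℝ) - meanY P Y i + z) ^ 2 = ((Y i ω : ℝ) - meanY P Y i) ^ 2
      + 2 * z * ((Y i ω : ℝ) - meanY P Y i) + z ^ 2 := fun ω => by ring
    have i1 : Integrable (fun ω => 2 * z * ((Y i ω : ℝ) - meanY P Y i)) P :=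
      ((R.memLp_centred i).integrable (by norm_num)).const_mul _
    have i2 : Integrable (fun ω => ((Y i ω : ℝ) - meanY P Y i) ^ 2
      + 2 * z * ((Y i ω : ℝ) - meanY P Y i)) P := (hsq i).add i1
    rw [integral_congr_ae (.of_forall h3), integral_add i2 (integrable_const _),
      integral_add (hsq i) i1, integral_const_mul, R.integral_centred]
    simp [varY]
  simp only [h2] at h
  rw [integral_add (R.integrable_index hn _) ((R.memLp_centredToll hn).mono_exponent (p := 2)
    (by norm_num)).integrable_sq, R.integral_index hn] at h
  change varY P Y n = _ at h
  rw [toll, h]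
  ring

end IsElectionRecursion

/-! ### Growth of the mean, the toll and the variance -/

theorem le_one_add_pow_three {x : ℝ} (hx : 0 ≤ x) : x ≤ 1 + x ^ 3 ∧ x ^ 2 ≤ 1 + x ^ 3 :=
  ⟨by nlinarith [sq_nonneg (x - 1)], by nlinarith [sq_nonneg (x - 1), mul_nonneg hx hx]⟩

theorem integrable_abs_pow_three {Ω : Type*} [MeasurableSpace Ω] {P : Measure Ω} {X : Ω → ℝ}
    (hX : MemLp X 3 P) : Integrable (fun ω => |X ω| ^ 3) P := by
  simpa using hX.integrable_norm_pow (p := 3) (by norm_num)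

namespace IsElectionRecursion

variable {Ω : Type*} [MeasurableSpace Ω] {P : Measure Ω}
  {Y I b : ℕ → Ω → ℕ}

theorem ae_abs_centredToll_le {A : ℝ} (R : IsElectionRecursion P Y I b)
    (hA : ∀ i n, i ≤ n → |meanY P Y n - meanY P Y i| ≤ A * lg n * (2 + (harm n - harm i)))
    {n : ℕ} (hn : 2 ≤ n) :
    ∀ᵐ ω ∂P, |centredToll P Y I b n ω| ≤ |(b n ω : ℝ) - Nat.log 2 n| + 2 * lg n
      + A * lg n * (2 + (harm n - harm (I n ω))) := by
  filter_upwards [R.ae_index_lt hn] with ω h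
  have h1 := hA _ _ h.le
  have h2 := natLog_le_two_mul_lg n
  have h3 : centredToll P Y I b n ω = ((b n ω : ℝ) - Nat.log 2 n) + Nat.log 2 n
      - (meanY P Y n - meanY P Y (I n ω)) := by simp only [centredToll]; ring
  rw [h3]
  refine (abs_sub _ _).trans (add_le_add ((abs_add_le _ _).trans (add_le_add le_rfl ?_)) h1)
  rwa [abs_of_nonneg (by positivity)]

theorem integral_two_add_harm_sub_cube_le (R : IsElectionRecursion P Y I b) {n : ℕ}
    (hn : 2 ≤ n) : ∫ ω, (2 + (harm n - harm (I n ω))) ^ 3 ∂P ≤ 56 := by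
  rw [R.integral_index hn fun i => (2 + (harm n - harm i)) ^ 3]
  exact average_two_add_harm_sub_cube_le (by omega)

variable [IsProbabilityMeasure P]

theorem exists_toll_meanY_near_log (R : IsElectionRecursion P Y I b) : ∃ D : ℝ, 0 ≤ D ∧
    ∀ n, 2 ≤ n → |toll (meanY P Y) n - Nat.log 2 n| ≤ D ∧
      ∫ ω, |(b n ω : ℝ) - Nat.log 2 n| ^ 3 ∂P ≤ D ∧
      ∫ ω, ((b n ω : ℝ) - Nat.log 2 n) ^ 2 ∂P ≤ D := by
  obtain ⟨C, hC, h⟩ := R.exists_moment_b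
  refine ⟨1 + C, by positivity, fun n hn => ?_⟩
  obtain ⟨h1, h2⟩ := h n hn
  have h3 : MemLp (fun ω => (b n ω : ℝ) - Nat.log 2 n) 3 P := h1.sub (memLp_const _)
  have i3 := integrable_abs_pow_three h3
  have i3' : Integrable (fun ω => 1 + |(b n ω : ℝ) - Nat.log 2 n| ^ 3) P :=
    (integrable_const _).add i3
  have e3 : ∫ ω, (1 + |(b n ω : ℝ) - Nat.log 2 n| ^ 3) ∂P ≤ 1 + C := by
    rw [integral_add (integrable_const _) i3]
    simpa using h2
  refine ⟨?_, h2.trans (by linarith), ?_⟩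
  · have : toll (meanY P Y) n - Nat.log 2 n = ∫ ω, ((b n ω : ℝ) - Nat.log 2 n) ∂P := by
      rw [integral_sub (R.integrable_b hn) (integrable_const _), R.toll_meanY hn]
      simp
    rw [this]
    refine abs_integral_le_integral_abs.trans ((integral_mono_of_nonneg
      (.of_forall fun _ => abs_nonneg _) i3' (.of_forall fun ω => ?_)).trans e3)
    exact (le_one_add_pow_three (abs_nonneg _)).1
  · refine (integral_mono_of_nonneg (.of_forall fun _ => sq_nonneg _) i3'
      (.of_forall fun ω => ?_)).trans e3
    simpa using (le_one_add_pow_three (abs_nonneg ((b n ω : ℝ) - Nat.log 2 n))).2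

theorem exists_abs_meanY_sub_le (R : IsElectionRecursion P Y I b) : ∃ A : ℝ, 0 ≤ A ∧
    ∀ i n, i ≤ n → |meanY P Y n - meanY P Y i| ≤ A * lg n * (2 + (harm n - harm i)) := by
  obtain ⟨D, hD, h⟩ := R.exists_toll_meanY_near_log
  refine ⟨D + 2, by positivity, fun i n hin => abs_sub_le_of_toll_le hin fun k hk => ?_⟩
  have h1 := one_le_lg k
  have h2 := lg_mono hk
  have h3 : (D + 2) * lg k ≤ (D + 2) * lg n := by gcongr
  refine le_trans ?_ h3
  rcases Nat.lt_or_ge k 2 with hk2 | hk2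
  · interval_cases k
    · simp only [toll, R.meanY_zero]; norm_num; nlinarith
    · simp only [toll, Finset.sum_range_one, R.meanY_zero, R.meanY_one]; norm_num; nlinarith
  · have h4 := abs_le.1 (h k hk2).1
    have h5 := natLog_le_two_mul_lg k
    have h6 : (0 : ℝ) ≤ Nat.log 2 k := by positivity
    rw [abs_le]
    constructor <;> nlinarith

theorem exists_integral_abs_centredToll_le (R : IsElectionRecursion P Y I b) :
    ∃ A : ℝ, 0 ≤ A ∧ ∀ n, 2 ≤ n →
      ∫ ω, |centredToll P Y I b n ω| ^ 3 ∂P ≤ A * lg n ^ 3 := by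
  obtain ⟨D, hD, h⟩ := R.exists_toll_meanY_near_log
  obtain ⟨A, hA, hm⟩ := R.exists_abs_meanY_sub_le
  obtain ⟨C, -, hb⟩ := R.exists_moment_b
  refine ⟨9 * D + 72 + 9 * A ^ 3 * 56, by positivity, fun n hn => ?_⟩
  have i3 : Integrable (fun ω => 9 * |(b n ω : ℝ) - Nat.log 2 n| ^ 3) P :=
    (integrable_abs_pow_three ((hb n hn).1.sub (memLp_const _))).const_mul 9
  have i4 : Integrable (fun ω => 9 * (A * lg n) ^ 3 * (2 + (harm n - harm (I n ω))) ^ 3) P :=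
    (R.integrable_index hn fun i => (2 + (harm n - harm i)) ^ 3).const_mul _
  have i5 : Integrable (fun ω => 9 * |(b n ω : ℝ) - Nat.log 2 n| ^ 3 + 9 * (2 * lg n) ^ 3) P :=
    i3.add (integrable_const _)
  have h1 := one_le_lg n
  have h2 : ∫ ω, |centredToll P Y I b n ω| ^ 3 ∂P ≤
      ∫ ω, (9 * |(b n ω : ℝ) - Nat.log 2 n| ^ 3 + 9 * (2 * lg n) ^ 3
        + 9 * (A * lg n) ^ 3 * (2 + (harm n - harm (I n ω))) ^ 3) ∂P := by
    refine integral_mono_of_nonneg (.of_forall fun _ => by positivity) (i5.add i4) ?_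
    filter_upwards [R.ae_abs_centredToll_le hm hn, R.ae_index_lt hn] with ω h3 h4
    have h5 := harm_mono h4.le
    have p1 := abs_nonneg ((b n ω : ℝ) - Nat.log 2 n)
    have p2 : 0 ≤ 2 * lg n := by linarith
    have p3 : 0 ≤ A * lg n * (2 + (harm n - harm (I n ω))) :=
      mul_nonneg (by positivity) (by linarith)
    have h6 := pow_le_pow_left₀ (abs_nonneg _) h3 3
    refine h6.trans ?_
    rw [show 9 * (A * lg n) ^ 3 * (2 + (harm n - harm (I n ω))) ^ 3 =
      9 * (A * lg n * (2 + (harm n - harm (I n ω)))) ^ 3 by ring]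
    generalize |(b n ω : ℝ) - Nat.log 2 n| = x at *
    generalize A * lg n * (2 + (harm n - harm (I n ω))) = z at *
    generalize 2 * lg n = y at *
    nlinarith [mul_nonneg (add_nonneg p1 p2) (sq_nonneg (x - y)),
      mul_nonneg (add_nonneg p1 p3) (sq_nonneg (x - z)),
      mul_nonneg (add_nonneg p2 p3) (sq_nonneg (y - z)), mul_nonneg p1 (sq_nonneg (x - y)),
      mul_nonneg p1 (sq_nonneg (y - z)), mul_nonneg p2 (sq_nonneg (x - z)),
      mul_nonneg p3 (sq_nonneg (x - y))]
  refine h2.trans ?_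
  rw [integral_add i5 i4, integral_add i3 (integrable_const _), integral_const,
    probReal_univ, one_smul, integral_const_mul, integral_const_mul]
  have h3 : 9 * (A * lg n) ^ 3 * ∫ ω, (2 + (harm n - harm (I n ω))) ^ 3 ∂P ≤
    9 * (A * lg n) ^ 3 * 56 := by gcongr; exact R.integral_two_add_harm_sub_cube_le hn
  have h4 := (h n hn).2.1
  have h5 : 1 ≤ lg n ^ 3 := one_le_pow₀ h1
  nlinarith

theorem toll_varY_nonneg (R : IsElectionRecursion P Y I b) {n : ℕ} (hn : 2 ≤ n) :
    0 ≤ toll (varY P Y) n := by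
  rw [R.toll_varY hn]
  exact integral_nonneg fun _ => sq_nonneg _

theorem exists_abs_varY_sub_le (R : IsElectionRecursion P Y I b) : ∃ A : ℝ, 1 ≤ A ∧
    ∀ i n, i ≤ n → |varY P Y n - varY P Y i| ≤ A * lg n ^ 2 * (2 + (harm n - harm i)) := by
  obtain ⟨A, hA, h⟩ := R.exists_integral_abs_centredToll_le
  refine ⟨1 + A, by linarith, fun i n hin => abs_sub_le_of_toll_le hin fun k hk => ?_⟩
  have h1 := one_le_lg k
  have h2 := lg_mono hk
  have h3 : (1 + A) * lg k ^ 2 ≤ (1 + A) * lg n ^ 2 := by gcongr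
  refine le_trans ?_ h3
  rcases Nat.lt_or_ge k 2 with hk2 | hk2
  · have : toll (varY P Y) k = 0 := by
      interval_cases k
      · simp [toll, R.varY_eq_zero]
      · simp [toll, R.varY_eq_zero]
    rw [this, abs_zero]
    positivity
  · rw [abs_of_nonneg (R.toll_varY_nonneg hk2), R.toll_varY hk2]
    have i3 := integrable_abs_pow_three (R.memLp_centredToll hk2)
    have i4 : Integrable (fun ω => lg k ^ 2 + |centredToll P Y I b k ω| ^ 3 / lg k) P :=
      (integrable_const _).add (i3.div_const _)
    calc ∫ ω, centredToll P Y I b k ω ^ 2 ∂P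
        ≤ ∫ ω, (lg k ^ 2 + |centredToll P Y I b k ω| ^ 3 / lg k) ∂P := by
          refine integral_mono_of_nonneg (.of_forall fun _ => sq_nonneg _) i4
            (.of_forall fun ω => ?_)
          have hl : 0 < lg k := by linarith
          have := (le_one_add_pow_three (x := |centredToll P Y I b k ω| / lg k)
            (by positivity)).2
          have e : centredToll P Y I b k ω ^ 2 =
              lg k ^ 2 * (|centredToll P Y I b k ω| / lg k) ^ 2 := by
            rw [div_pow, sq_abs]; field_simp
          have e2 : lg k ^ 2 + |centredToll P Y I b k ω| ^ 3 / lg k =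
              lg k ^ 2 * (1 + (|centredToll P Y I b k ω| / lg k) ^ 3) := by
            field_simp
          simp only [e, e2]
          gcongr
      _ = lg k ^ 2 + (∫ ω, |centredToll P Y I b k ω| ^ 3 ∂P) / lg k := by
          rw [integral_add (integrable_const _) (i3.div_const _), integral_div]
          simp
      _ ≤ lg k ^ 2 + A * lg k ^ 3 / lg k := by
          gcongr
          exact h k hk2
      _ = (1 + A) * lg k ^ 2 := by field_simp

/-- For indices in the upper third of the range the mean has not yet caught up with half of the
toll. -/
theorem exists_natLog_sub_meanY_sub_ge (R : IsElectionRecursion P Y I b) : ∃ E : ℝ,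
    ∀ i n, 2 ≤ i → i ≤ n → 2 * n ≤ 3 * i →
      (Nat.log 2 n : ℝ) / 2 - E ≤ Nat.log 2 n - (meanY P Y n - meanY P Y i) := by
  obtain ⟨D, hD, h⟩ := R.exists_toll_meanY_near_log
  refine ⟨1 + 3 * D, fun i n hi hin h2 => ?_⟩
  have h3 := sub_toll_sub_le (x := meanY P Y) (T := Nat.log 2 n + D) hin fun k hk1 hk2 => by
    have h4 := (abs_le.1 (h k (by omega)).1).2
    have h5 : (Nat.log 2 k : ℝ) ≤ Nat.log 2 n := by exact_mod_cast Nat.log_mono_right hk2.le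
    linarith
  have h4 := abs_le.1 (h n (by omega)).1
  have h5 := abs_le.1 (h i hi).1
  have h6 : (Nat.log 2 n : ℝ) ≤ Nat.log 2 i + 1 := by
    have : Nat.log 2 n ≤ Nat.log 2 (i * 2) := Nat.log_mono_right (by omega)
    rw [Nat.log_mul_base (by norm_num) (by omega)] at this
    exact_mod_cast this
  have h7 : harm n - harm i ≤ 1 / 2 := by
    refine (harm_sub_harm_le hin (by omega)).trans ?_
    have h8 : (2 * n : ℝ) ≤ 3 * i := by exact_mod_cast h2
    rw [div_le_iff₀ (by exact_mod_cast (by omega : 0 < i))]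
    linarith
  have h8 : (Nat.log 2 n + D) * (harm n - harm i) ≤ (Nat.log 2 n + D) * (1 / 2) := by gcongr
  linarith

/-- The toll does not depend on the coupling of `I n` and `b n` to leading order: as `b n` is
concentrated, its randomness cannot cancel that of `I n`. -/
theorem exists_toll_varY_ge (R : IsElectionRecursion P Y I b) :
    ∃ c : ℝ, 0 < c ∧ ∀ᶠ n in atTop, c * lg n ^ 2 ≤ toll (varY P Y) n := by
  obtain ⟨D, hD, h⟩ := R.exists_toll_meanY_near_log
  obtain ⟨E, hE⟩ := R.exists_natLog_sub_meanY_sub_ge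
  obtain ⟨C, -, hb⟩ := R.exists_moment_b
  refine ⟨1 / 1024, by norm_num, ?_⟩
  filter_upwards [eventually_ge_atTop 8, tendsto_lg.eventually_ge_atTop
    (max 6 (max (1024 * (D + 1)) (8 * |E|)))] with n hn hl
  have hl1 : 6 ≤ lg n := (le_max_left _ _).trans hl
  have hl2 : 1024 * (D + 1) ≤ lg n := (le_max_left _ _).trans ((le_max_right _ _).trans hl)
  have hl3 : 8 * |E| ≤ lg n := (le_max_right _ _).trans ((le_max_right _ _).trans hl)
  have hκ : lg n / 2 ≤ Nat.log 2 n := by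
    have := lg_le_natLog_add (n := n) (by omega)
    linarith
  have hEl := le_abs_self E
  set G : ℕ → ℝ := fun i => (Nat.log 2 n : ℝ) - (meanY P Y n - meanY P Y i) with hG
  have hn2 : 2 ≤ n := by omega
  have i1 : Integrable (fun ω => G (I n ω) ^ 2 / 2) P :=
    R.integrable_index hn2 fun i => G i ^ 2 / 2
  have i2 : Integrable (fun ω => ((b n ω : ℝ) - Nat.log 2 n) ^ 2) P :=
    (((hb n hn2).1.sub (memLp_const _)).mono_exponent (p := 2) (by norm_num)).integrable_sq
  have h1 : ∫ ω, G (I n ω) ^ 2 / 2 ∂P - ∫ ω, ((b n ω : ℝ) - Nat.log 2 n) ^ 2 ∂P ≤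
      toll (varY P Y) n := by
    rw [R.toll_varY hn2, ← integral_sub i1 i2]
    refine integral_mono (i1.sub i2) ((R.memLp_centredToll hn2).mono_exponent (p := 2)
      (by norm_num)).integrable_sq fun ω => ?_
    have e : centredToll P Y I b n ω = ((b n ω : ℝ) - Nat.log 2 n) + G (I n ω) := by
      simp only [centredToll, hG]; ring
    simp only [e]
    nlinarith [sq_nonneg (2 * ((b n ω : ℝ) - Nat.log 2 n) + G (I n ω))]
  have h2 : lg n ^ 2 / 512 ≤ ∫ ω, G (I n ω) ^ 2 / 2 ∂P := by
    have hn' : (0 : ℝ) < n := by exact_mod_cast (by omega : 0 < n)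
    rw [R.integral_index hn2 fun i => G i ^ 2 / 2, le_div_iff₀ hn']
    -- For `8 ≤ n` at least a quarter of the indices `i < n` satisfy `2 * n ≤ 3 * i`.
    have hcard : (n : ℝ) / 4 ≤ ((Finset.Ico ((2 * n + 2) / 3) n).card : ℝ) := by
      have : n ≤ 4 * (Finset.Ico ((2 * n + 2) / 3) n).card := by rw [Nat.card_Ico]; omega
      have : (n : ℝ) ≤ 4 * ((Finset.Ico ((2 * n + 2) / 3) n).card : ℝ) := by exact_mod_cast this
      linarith
    calc lg n ^ 2 / 512 * n = n / 4 * ((lg n / 8) ^ 2 / 2) := by ring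
      _ ≤ ((Finset.Ico ((2 * n + 2) / 3) n).card : ℝ) * ((lg n / 8) ^ 2 / 2) := by gcongr
      _ = ∑ i ∈ Finset.Ico ((2 * n + 2) / 3) n, (lg n / 8) ^ 2 / 2 := by simp
      _ ≤ ∑ i ∈ Finset.Ico ((2 * n + 2) / 3) n, G i ^ 2 / 2 := by
          refine Finset.sum_le_sum fun i hi => ?_
          rw [Finset.mem_Ico] at hi
          have h3 := hE i n (by omega) hi.2.le (by omega)
          have h4 : lg n / 8 ≤ G i := by linarith
          gcongr
      _ ≤ ∑ i ∈ Finset.range n, G i ^ 2 / 2 := by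
          refine Finset.sum_le_sum_of_subset_of_nonneg (fun i hi => ?_) fun _ _ _ => by positivity
          rw [Finset.mem_Ico] at hi
          exact Finset.mem_range.2 hi.2
  have h3 := (h n hn2).2.2
  nlinarith

end IsElectionRecursion

/-! ### The Zolotarev distance to the Gaussian law -/

namespace IsElectionRecursion

variable {Ω : Type*} [MeasurableSpace Ω] {P : Measure Ω} [IsProbabilityMeasure P]
  {Y I b : ℕ → Ω → ℕ}

/-- The centred `Y n` is at `ζ₃`-distance of order `ln ^ 4 n` from the Gaussian law of the same
variance. -/
theorem exists_abs_integral_sub_gaussianReal_le (R : IsElectionRecursion P Y I b) :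
    ∃ K : ℝ, 0 ≤ K ∧ ∀ n, ∀ f f' f'' : ℝ → ℝ, IsZolotarevTest f f' f'' →
      |∫ ω, f ((Y n ω : ℝ) - meanY P Y n) ∂P
        - ∫ x, f x ∂gaussianReal 0 (varY P Y n).toNNReal| ≤ K * lg n ^ 4 := by
  obtain ⟨K₀, hK₀, hexp⟩ := exists_gaussian_expansion
  obtain ⟨A, hA, hZ⟩ := R.exists_integral_abs_centredToll_le
  obtain ⟨B, hB, hv⟩ := R.exists_abs_varY_sub_le
  refine ⟨K₀ * (A + 56 * B ^ 3), by positivity, fun n => ?_⟩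
  set K := K₀ * (A + 56 * B ^ 3) with hK
  have hK0 : 0 ≤ K := by positivity
  have hvar (n : ℕ) : ((varY P Y n).toNNReal : ℝ) = varY P Y n :=
    Real.coe_toNNReal _ (varY_nonneg P Y n)
  induction n using Nat.strong_induction_on with
  | _ n ih =>
  intro f f' f'' hf
  rcases Nat.lt_or_ge n 2 with hn | hn
  · rw [R.varY_eq_zero hn, Real.toNNReal_zero, gaussianReal_zero_var, integral_dirac,
      integral_congr_ae (g := fun _ => f 0)]
    · simp only [integral_const, probReal_univ, one_smul, sub_self, abs_zero]
      have := one_le_lg n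
      positivity
    · filter_upwards [R.ae_centred_eq_zero hn] with ω h
      rw [h]
  obtain ⟨hU, hrec⟩ := R.integral_rec hn (g := fun k => f ((k : ℝ) - meanY P Y n))
    (hf.integrable_comp (R.memLp_centred n)).1
  simp only [add_sub_meanY_eq] at hU hrec
  set Z := centredToll P Y I b n with hZdef
  set U : Ω → ℝ := fun ω' =>
    ∫ ω, f (((Y (I n ω') ω : ℝ) - meanY P Y (I n ω')) + Z ω') ∂P with hUdef
  set F0 := ∫ x, f x ∂gaussianReal 0 (varY P Y n).toNNReal
  set F1 := ∫ x, f' x ∂gaussianReal 0 (varY P Y n).toNNReal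
  set F2 := ∫ x, f'' x ∂gaussianReal 0 (varY P Y n).toNNReal
  set W : Ω → ℝ := fun ω' =>
    F0 + Z ω' * F1 + (Z ω' ^ 2 + (varY P Y (I n ω') - varY P Y n)) / 2 * F2 with hWdef
  have iZ : Integrable Z P := (R.memLp_centredToll hn).integrable (by norm_num)
  have iZ2 : Integrable (fun ω => Z ω ^ 2) P :=
    ((R.memLp_centredToll hn).mono_exponent (p := 2) (by norm_num)).integrable_sq
  have iZ3 : Integrable (fun ω => |Z ω| ^ 3) P := integrable_abs_pow_three (R.memLp_centredToll hn)
  have iV : Integrable (fun ω => varY P Y (I n ω) - varY P Y n) P :=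
    R.integrable_index hn fun i => varY P Y i - varY P Y n
  have iW1 : Integrable (fun ω => F0 + Z ω * F1) P := (integrable_const _).add (iZ.mul_const _)
  have iW2 : Integrable (fun ω => (Z ω ^ 2 + (varY P Y (I n ω) - varY P Y n)) / 2 * F2) P :=
    ((iZ2.add iV).div_const 2).mul_const F2
  have iW : Integrable W P := iW1.add iW2
  -- The first two moments match, so that the expansion integrates to its constant term.
  have hW : ∫ ω, W ω ∂P = F0 := by
    have hV : ∫ ω, (varY P Y (I n ω) - varY P Y n) ∂P = -∫ ω, Z ω ^ 2 ∂P := by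
      rw [integral_sub (R.integrable_index hn _) (integrable_const _), R.integral_index hn,
        ← R.toll_varY hn, toll]
      simp
    simp only [hWdef]
    rw [integral_add iW1 iW2, integral_add (integrable_const _) (iZ.mul_const _),
      integral_mul_const, integral_mul_const, integral_div, integral_add iZ2 iV, hV,
      R.integral_centredToll hn]
    simp
  have hUW : ∀ᵐ ω ∂P, |U ω - W ω| ≤ K * lg (I n ω) ^ 4 +
      (K₀ * |Z ω| ^ 3 + K₀ * (B * lg n) ^ 3 * (2 + (harm n - harm (I n ω))) ^ 3) := by
    filter_upwards [R.ae_index_lt hn] with ω h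
    have h1 := ih (I n ω) h _ _ _ (hf.translate (Z ω))
    have h2 := hexp f f' f'' hf (varY P Y n).toNNReal (varY P Y (I n ω)).toNNReal (Z ω)
    have h3 : ∫ x, f (x + Z ω) ∂gaussianReal 0 (varY P Y (I n ω)).toNNReal =
        ∫ x, f x ∂gaussianReal (Z ω) (varY P Y (I n ω)).toNNReal := by
      have := gaussianReal_map_add_const (μ := 0) (v := (varY P Y (I n ω)).toNNReal) (Z ω)
      rw [zero_add] at this
      rw [← this, integral_map (by fun_prop) hf.continuous.aestronglyMeasurable]
    rw [h3] at h1
    rw [hvar, hvar] at h2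
    have h4 : √|varY P Y (I n ω) - varY P Y n| ≤ B * lg n * (2 + (harm n - harm (I n ω))) := by
      have h5 := hv _ _ h.le
      have h6 := harm_mono h.le
      have h7 := one_le_lg n
      rw [abs_sub_comm]
      refine Real.sqrt_le_iff.2 ⟨mul_nonneg (by positivity) (by linarith), h5.trans ?_⟩
      have h8 : 1 ≤ 2 + (harm n - harm (I n ω)) := by linarith
      calc B * lg n ^ 2 * (2 + (harm n - harm (I n ω)))
          ≤ B ^ 2 * lg n ^ 2 * (2 + (harm n - harm (I n ω))) ^ 2 := by
            gcongr
            · exact le_self_pow₀ hB (by norm_num)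
            · exact le_self_pow₀ h8 (by norm_num)
        _ = _ := by ring
    have h5 : K₀ * (|Z ω| ^ 3 + √|varY P Y (I n ω) - varY P Y n| ^ 3) ≤
        K₀ * |Z ω| ^ 3 + K₀ * (B * lg n) ^ 3 * (2 + (harm n - harm (I n ω))) ^ 3 := by
      calc _ ≤ K₀ * (|Z ω| ^ 3 + (B * lg n * (2 + (harm n - harm (I n ω)))) ^ 3) := by gcongr
        _ = _ := by ring
    exact (abs_sub_le _ _ _).trans (add_le_add h1 (h2.trans h5))
  have i1 : Integrable (fun ω => K * lg (I n ω) ^ 4) P :=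
    R.integrable_index hn fun i => K * lg i ^ 4
  have i2 : Integrable (fun ω => K₀ * (B * lg n) ^ 3 * (2 + (harm n - harm (I n ω))) ^ 3) P :=
    R.integrable_index hn fun i => K₀ * (B * lg n) ^ 3 * (2 + (harm n - harm i)) ^ 3
  have i3 : Integrable (fun ω => K₀ * |Z ω| ^ 3
      + K₀ * (B * lg n) ^ 3 * (2 + (harm n - harm (I n ω))) ^ 3) P := (iZ3.const_mul _).add i2
  have hl := one_le_lg n
  calc |∫ ω, f ((Y n ω : ℝ) - meanY P Y n) ∂P - F0| = |∫ ω, (U ω - W ω) ∂P| := by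
        rw [integral_sub hU iW, hW, hrec]
    _ ≤ ∫ ω, |U ω - W ω| ∂P := abs_integral_le_integral_abs
    _ ≤ ∫ ω, (K * lg (I n ω) ^ 4 + (K₀ * |Z ω| ^ 3
          + K₀ * (B * lg n) ^ 3 * (2 + (harm n - harm (I n ω))) ^ 3)) ∂P :=
        integral_mono_ae (hU.sub iW).abs (i1.add i3) hUW
    _ = K * ((∑ i ∈ Finset.range n, lg i ^ 4) / n) + (K₀ * ∫ ω, |Z ω| ^ 3 ∂P
          + K₀ * (B * lg n) ^ 3 * ∫ ω, (2 + (harm n - harm (I n ω))) ^ 3 ∂P) := by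
        rw [integral_add i1 i3, integral_add (iZ3.const_mul _) i2, integral_const_mul,
          integral_const_mul, integral_const_mul, R.integral_index hn fun i => lg i ^ 4]
    _ ≤ K * (lg n ^ 4 - lg n ^ 3) + (K₀ * (A * lg n ^ 3) + K₀ * (B * lg n) ^ 3 * 56) := by
        gcongr
        · exact average_lg_pow_four_le (by omega)
        · exact hZ n hn
        · exact R.integral_two_add_harm_sub_cube_le hn
    _ = K * lg n ^ 4 := by rw [hK]; ring

theorem variance_eq_varY (R : IsElectionRecursion P Y I b) (n : ℕ) :
    variance (fun ω => (Y n ω : ℝ)) P = varY P Y n :=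
  variance_eq_integral (R.memLp_Y n).aestronglyMeasurable.aemeasurable

/-- Rescaling the estimate for the centred variables to unit variance. -/
theorem zolotarev3_standardize_le (R : IsElectionRecursion P Y I b) {n : ℕ} {B : ℝ}
    (hpos : 0 < varY P Y n) (hB : ∀ f f' f'' : ℝ → ℝ, IsZolotarevTest f f' f'' →
      |∫ ω, f ((Y n ω : ℝ) - meanY P Y n) ∂P
        - ∫ x, f x ∂gaussianReal 0 (varY P Y n).toNNReal| ≤ B) :
    zolotarev3 (P.map (standardize P fun ω => (Y n ω : ℝ))) (gaussianReal 0 1) ≤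
      ENNReal.ofReal (B / √(varY P Y n) ^ 3) := by
  refine iSup₂_le fun f hf => ENNReal.ofReal_le_ofReal ?_
  have hT := isZolotarevTest_of_mem hf
  have hσ : 0 < √(varY P Y n) := Real.sqrt_pos.2 hpos
  have hvar : ((varY P Y n).toNNReal : ℝ) = varY P Y n := Real.coe_toNNReal _ hpos.le
  have h1 := hB _ _ _ (hT.rescale hσ)
  have hm : AEMeasurable (standardize P fun ω => (Y n ω : ℝ)) P :=
    ((R.memLp_centred n).aestronglyMeasurable.aemeasurable).div_const _
  rw [integral_map hm hT.continuous.aestronglyMeasurable]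
  rw [integral_gaussianReal_eq 0 _ (hT.rescale hσ).continuous, hvar, integral_const_mul,
    integral_const_mul, ← mul_sub, abs_mul, abs_of_pos (by positivity)] at h1
  have h2 (x : ℝ) : (0 + √(varY P Y n) * x) / √(varY P Y n) = x := by field_simp; ring
  simp only [h2] at h1
  rw [le_div_iff₀ (by positivity), mul_comm]
  simp only [standardize, R.variance_eq_varY]
  exact h1

end IsElectionRecursion

theorem corollary4p1 {Ω : Type*} [MeasurableSpace Ω] (P : Measure Ω) [IsProbabilityMeasure P]
    (Y I b : ℕ → Ω → ℕ)
    (hY : ∀ n, Measurable (Y n)) (hI : ∀ n, Measurable (I n)) (hb : ∀ n, Measurable (b n))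
    (hY0 : ∀ᵐ ω ∂P, Y 0 ω = 1) (hY1 : ∀ᵐ ω ∂P, Y 1 ω = 1)
    (hIlaw : ∀ n, 2 ≤ n → P.map (I n) = uniformOn (Set.Iio n))
    (hblaw : ∀ n, 2 ≤ n → P.map (b n) = electionLaw n)
    (hindep : ∀ n, 2 ≤ n → IndepFun (fun ω => (I n ω, b n ω)) (fun ω k => Y k ω) P)
    (hrec : ∀ n, 2 ≤ n → P.map (Y n) = P.map (fun ω => Y (I n ω) ω + b n ω)) :
    (∀ n, MemLp (fun ω => (Y n ω : ℝ)) 3 P) ∧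
    ∃ C : ℝ, ∀ᶠ n : ℕ in atTop,
      0 < variance (fun ω => (Y n ω : ℝ)) P ∧
      zolotarev3 (P.map (standardize P fun ω => (Y n ω : ℝ))) (gaussianReal 0 1) ≤
        ENNReal.ofReal (C / √(Real.log n)) := by
  have R : IsElectionRecursion P Y I b := ⟨hY, hI, hb, hY0, hY1, hIlaw, hblaw, hindep, hrec⟩
  refine ⟨R.memLp_Y, ?_⟩
  obtain ⟨K, hK, hbound⟩ := R.exists_abs_integral_sub_gaussianReal_le
  obtain ⟨c₀, hc₀, htoll⟩ := R.exists_toll_varY_ge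
  obtain ⟨c, hc, hvar⟩ := exists_lg_pow_three_le_of_toll hc₀ htoll
  refine ⟨K / √c ^ 3, ?_⟩
  filter_upwards [hvar, eventually_ge_atTop 2] with n hn hn2
  have hl := one_le_lg n
  have hpos : 0 < varY P Y n := lt_of_lt_of_le (by positivity) hn
  refine ⟨by rwa [R.variance_eq_varY], ?_⟩
  refine (R.zolotarev3_standardize_le hpos (hbound n)).trans (ENNReal.ofReal_le_ofReal ?_)
  have hlog : 0 < Real.log n := Real.log_pos (by exact_mod_cast hn2)
  have h1 : √c * (lg n * √(lg n)) ≤ √(varY P Y n) := by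
    have e : lg n * √(lg n) = √(lg n ^ 3) := by
      rw [pow_succ, Real.sqrt_mul (by positivity), Real.sqrt_sq (by positivity)]
    rw [e, ← Real.sqrt_mul hc.le]
    exact Real.sqrt_le_sqrt hn
  have hc3 : 0 < √c := Real.sqrt_pos.2 hc
  have hl3 : 0 < √(lg n) := Real.sqrt_pos.2 (by linarith)
  rw [div_div]
  calc K * lg n ^ 4 / √(varY P Y n) ^ 3
      ≤ K * lg n ^ 4 / (√c * (lg n * √(lg n))) ^ 3 := by gcongr
    _ = K / (√c ^ 3 * √(lg n)) := by
        have : √(lg n) ^ 2 = lg n := Real.sq_sqrt (by positivity)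
        rw [div_eq_div_iff (by positivity) (by positivity)]
        calc _ = K * √c ^ 3 * lg n ^ 3 * √(lg n) * lg n := by ring
          _ = K * √c ^ 3 * lg n ^ 3 * √(lg n) * √(lg n) ^ 2 := by rw [this]
          _ = _ := by ring
    _ ≤ K / (√c ^ 3 * √(Real.log n)) := by
        have := Real.sqrt_le_sqrt (log_le_lg n)
        have := Real.sqrt_pos.2 hlog
        gcongr
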